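/- Let $(M,g)$ be a nonempty compact Riemannian manifold of dimension $n\ge 2$, possibly with boundary $\partial M$, let $v_g$ be its Riemannian volume measure, and let $\rho,\sigma$ be positive continuous functions on $M$. For $k\ge 0$ define the weighted Neumann eigenvalues by $$\mu_k(\rho,\sigma)=\inf_{E}\ \sup_{u\in E\setminus\{0\}}\frac{\int_M|\nabla u|^2\,\sigma\,v_g}{\int_M u^2\,\rho\,v_g},$$ where $E$ ranges over the $(k+1)$-dimensional vector subspaces of the Sobolev space $H^1(M)$ (the closure of $C^\infty(M)$ for the norm $(\|u\|_{L^2}^2+\|\nabla u\|_{L^2}^2)^{1/2}$). Define the weighted Cheeger constant $$h_{\rho,\sigma}(M)=\inf_{D}\frac{|\partial D\setminus\partial M|_\sigma}{|D|_\rho},$$ where $D$ ranges over the nonempty open subsets of $M$ whose relative boundary $\partial D\setminus\partial M$ is smooth (that is, near each point of $\partial D\setminus \partial M$ the set $D$ is of the form $\{\varphi>0\}$ with $\varphi$ smooth and $d\varphi\neq0$) and which satisfy $|D|_\sigma\le\frac12|M|_\sigma$. Here $|D|_w=\int_D w\,v_g$, and $|\partial D\setminus\partial M|_\sigma$ is the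 integral of $\sigma$ over $\partial D\setminus\partial M$ with respect to the induced $(n-1)$-dimensional Riemannian measure. The constant $h_{\sigma,\sigma}(M)$ is defined in the same way, with $\rho$ replaced by $\sigma$. Then $$\mu_1(\rho,\sigma)\ \ge\ \frac14\,h_{\sigma,\sigma}(M)\,h_{\rho,\sigma}(M).$$ -/

import Mathlib

open Bundle Manifold MeasureTheory Filter Set
open scoped ENNReal ContDiff Topology

noncomputable section

namespace WeightedNeumann

section Definitions

variable {n : ℕ} {H : Type*} [TopologicalSpace H]
  (I : ModelWithCorners ℝ (EuclideanSpace ℝ (Fin n)) H)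
  {M : Type*} [EMetricSpace M] [ChartedSpace H M]

/-- `D` is open and its relative boundary `∂D \ ∂M` is smooth: near each of its points, `D` is
the set where some smooth function without critical point there is positive. -/
def IsSmoothDomain (D : Set M) : Prop :=
  IsOpen D ∧ ∀ x ∈ frontier D \ I.boundary M, ∃ U : Set M, IsOpen U ∧ x ∈ U ∧
    ∃ φ : M → ℝ, ContMDiffOn I 𝓘(ℝ, ℝ) ∞ φ U ∧ mfderiv I 𝓘(ℝ, ℝ) φ x ≠ 0 ∧
      D ∩ U = {y ∈ U | 0 < φ y}

section

variable [RiemannianBundle (fun x : M ↦ TangentSpace I x)]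

/-- The Riemannian gradient at `x` of a function `f` on `M`: `g(∇f, v) = df(v)` for all `v`. -/
def riemannianGradient (f : M → ℝ) (x : M) : TangentSpace I x :=
  haveI : FiniteDimensional ℝ (TangentSpace I x) :=
    inferInstanceAs (FiniteDimensional ℝ (EuclideanSpace ℝ (Fin n)))
  haveI : CompleteSpace (TangentSpace I x) := FiniteDimensional.complete ℝ _
  (InnerProductSpace.toDual ℝ (TangentSpace I x)).symm (mfderiv I 𝓘(ℝ, ℝ) f x)

end

variable [MeasurableSpace M] [BorelSpace M]

/-- The `d`-dimensional volume of `A` for the density `w`, i.e. the integral of `w` over `A` with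
respect to the `d`-dimensional Riemannian volume. The latter is the `d`-dimensional Hausdorff
measure of the (Riemannian) distance of `M`, normalized so as to agree with Lebesgue measure on
`d`-dimensional Euclidean space. For `d = n` it is the Riemannian volume measure `v_g`, and on
hypersurfaces, for `d = n - 1`, it is the measure induced by `v_g`. -/
def weightedVolume (d : ℕ) (w : M → ℝ) (A : Set M) : ℝ≥0∞ :=
  ∫⁻ x in A, ENNReal.ofReal (w x) ∂(μHE[d] : Measure M)

/-- The weighted Cheeger constant `h_{ρ,σ}(M)`: the infimum of `|∂D \ ∂M|_σ / |D|_ρ` over the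
nonempty smooth domains `D` with `|D|_σ ≤ |M|_σ / 2`. -/
def cheegerConstant (ρ σ : M → ℝ) : ℝ≥0∞ :=
  ⨅ (D : Set M) (_ : IsSmoothDomain I D) (_ : D.Nonempty)
    (_ : weightedVolume n σ D ≤ weightedVolume n σ univ / 2),
    weightedVolume (n - 1) σ (frontier D \ I.boundary M) / weightedVolume n ρ D

variable [IsManifold I ∞ M] [RiemannianBundle (fun x : M ↦ TangentSpace I x)]

/-- The measurable vector field `V` is the gradient of `u ∈ L²(M)` in the sense of `H¹(M)`, the
completion of `C^∞(M)` for the norm `(‖f‖² + ‖∇f‖²)^{1/2}` where `‖·‖` is the `L²`-norm: some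
sequence `f j` in `C^∞(M)` satisfies `f j → u` and `∇(f j) → V` in `L²`. -/
def IsSobolevGradient (u : Lp ℝ 2 (μHE[n] : Measure M)) (V : (x : M) → TangentSpace I x) :
    Prop :=
  Measurable[_, borel (TangentBundle I M)] (fun x ↦ (⟨x, V x⟩ : TangentBundle I M)) ∧
  ∃ f : ℕ → M → ℝ, (∀ j, ContMDiff I 𝓘(ℝ, ℝ) ∞ (f j)) ∧
    Tendsto (fun j ↦ ∫⁻ x, ‖f j x - u x‖ₑ ^ 2 ∂(μHE[n] : Measure M)) atTop (𝓝 0) ∧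
    Tendsto (fun j ↦ ∫⁻ x, ‖riemannianGradient I (f j) x - V x‖ₑ ^ 2 ∂(μHE[n] : Measure M)) atTop (𝓝 0)

/-- `u` belongs to the Sobolev space `H¹(M)`. -/
def MemH1 (u : Lp ℝ 2 (μHE[n] : Measure M)) : Prop :=
  ∃ V : (x : M) → TangentSpace I x, IsSobolevGradient I u V

open Classical in
/-- The gradient of `u ∈ H¹(M)`, which is unique up to null sets (and `0` if `u ∉ H¹(M)`). -/
def sobolevGradient (u : Lp ℝ 2 (μHE[n] : Measure M)) : (x : M) → TangentSpace I x :=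
  if h : MemH1 I u then h.choose else fun _ ↦ 0

/-- The Rayleigh quotient `∫ |∇u|² σ v_g / ∫ u² ρ v_g`. -/
def rayleighQuotient (ρ σ : M → ℝ) (u : Lp ℝ 2 (μHE[n] : Measure M)) : ℝ≥0∞ :=
  (∫⁻ x, ‖sobolevGradient I u x‖ₑ ^ 2 * ENNReal.ofReal (σ x) ∂(μHE[n] : Measure M)) /
    ∫⁻ x, ‖u x‖ₑ ^ 2 * ENNReal.ofReal (ρ x) ∂(μHE[n] : Measure M)

/-- The weighted Neumann eigenvalue `μ_k(ρ,σ)` (numbered from `k = 0`): the infimum, over the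
`(k+1)`-dimensional vector subspaces `E` of `H¹(M)`, of the supremum of the Rayleigh quotient
over `E \ {0}`. -/
def eigenvalue (ρ σ : M → ℝ) (k : ℕ) : ℝ≥0∞ :=
  ⨅ (E : Submodule ℝ (Lp ℝ 2 (μHE[n] : Measure M))) (_ : Module.finrank ℝ E = k + 1)
    (_ : ∀ u ∈ E, MemH1 I u),
    ⨆ (u : Lp ℝ 2 (μHE[n] : Measure M)) (_ : u ∈ E) (_ : u ≠ 0), rayleighQuotient I ρ σ u

end Definitions

end WeightedNeumann

end

/-!
Cheeger's inequality with two weights.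

The proof follows Cheeger. Let `E` be a two-dimensional space in `H¹(M)`. It contains some `u ≠ 0`
with `∫ u ρ = 0`, and it suffices to bound the Rayleigh quotient of this `u` from below. For a
smooth function `f`, choose a `σ`-median `c`, so that the superlevel sets of `(f - c)⁺` and of
`(f - c)⁻` at positive levels have at most half of the `σ`-volume of `M`. For almost every level
such a set is a smooth domain, and its boundary lies in a level set, so that the coarea formula, the
definitions of the two Cheeger constants and the layer cake formula give, for `g = (f - c)^±`,
`h_{σ,σ} ∫ g² σ ≤ 2 ∫ g |∇f| σ` and `h_{ρ,σ} ∫ g² ρ ≤ 2 ∫ g |∇f| σ`, the integrals on the right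
extending over `{g > 0}`. Multiplying these and using the Cauchy–Schwarz inequality
`(∫ g |∇f| σ)² ≤ ∫ g² σ ∫ |∇f|² σ` one obtains
`¼ h_{σ,σ} h_{ρ,σ} ∫ (f - c)² ρ ≤ ∫ |∇f|² σ`. Applying this to smooth `f j → u` with `∇(f j) → V`
in `L²` and using that `∫ (u - c)² ρ ≥ ∫ u² ρ` for every `c`, one obtains the inequality for `u`
and for any Sobolev gradient `V` of `u`; the uniqueness of `V` is not needed.

Three ingredients are proved here.

* *Sard's theorem* for real-valued smooth functions,
  `volume_image_critical_eq_zero`, by induction on the dimension: near a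
  critical point, the points where one derivative of `f` is the first not to vanish lie in a smooth
  hypersurface; where many derivatives vanish, Taylor's formula makes the image null. Only interior
  critical points matter, as smoothness of `∂D` is required off `∂M`.
* *The coarea inequality* `lintegral_levelSet_le`, of which only `≤` is needed: the integral over
  `t` of the `w`-weighted `(n-1)`-dimensional measure of the noncritical points of `{f = t} \ ∂M` is
  at most `∫ w |∇f|`. Near each interior point where `∇f ≠ 0` there are coordinates, the first of
  which is `f` up to scaling, with bi-Lipschitz constants as close to `1` as desired. In these the
  inequality is Fubini's theorem (`exists_nhds_slice_le`), since the normalized Hausdorff measures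
  change by a factor close to `1` under such maps.
* *The structure of superlevel sets*, `isSmoothDomain_superlevel`: at a regular value `t`, the set
  `{t < f}` is a smooth domain.
-/

noncomputable section

namespace WeightedNeumann

/-! ### Sard's theorem for real-valued functions -/

lemma volume_image_eq_zero_of_locally {X : Type*} [TopologicalSpace X] [SecondCountableTopology X]
    {f : X → ℝ} {S : Set X} (h : ∀ x ∈ S, ∃ u ∈ 𝓝 x, volume (f '' (u ∩ S)) = 0) :
    volume (f '' S) = 0 := by
  choose! u hu hu0 using h
  obtain ⟨t, htS, htc, ht⟩ := TopologicalSpace.countable_cover_nhdsWithin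
    (f := u) (s := S) fun x hx ↦ mem_nhdsWithin_of_mem_nhds (hu x hx)
  have hsub : f '' S ⊆ ⋃ x ∈ t, f '' (u x ∩ S) := by
    rintro _ ⟨y, hy, rfl⟩
    obtain ⟨x, hx, hyx⟩ := mem_iUnion₂.1 (ht hy)
    exact mem_iUnion₂.2 ⟨x, hx, y, ⟨hyx, hy⟩, rfl⟩
  exact measure_mono_null hsub ((measure_biUnion_null_iff htc).2 fun x hx ↦ hu0 x (htS hx))

/-- A Taylor estimate which is locally uniform in the base point: where the derivatives of orders
`1, …, k` vanish, `f` varies to order `k + 1`. -/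
lemma exists_norm_sub_le_pow_of_iteratedFDeriv_eq_zero {E : Type} [NormedAddCommGroup E]
    [NormedSpace ℝ E] (k : ℕ) :
    ∀ {F : Type} [NormedAddCommGroup F] [NormedSpace ℝ F] {f : E → F} {x₀ : E},
      ContDiffAt ℝ (k + 1 : ℕ) f x₀ → ∃ U ∈ 𝓝 x₀, ∃ C : ℝ, 0 ≤ C ∧ ∀ x ∈ U, ∀ y ∈ U,
        (∀ i, 1 ≤ i → i ≤ k → iteratedFDeriv ℝ i f x = 0) →
          ‖f y - f x‖ ≤ C * ‖y - x‖ ^ (k + 1) := by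
  induction k with
  | zero =>
    intro F _ _ f x₀ hf
    obtain ⟨K, t, ht, hK⟩ := ContDiffAt.exists_lipschitzOnWith (by simpa using hf)
    refine ⟨t, ht, K, K.2, fun x hx y hy _ ↦ ?_⟩
    simpa using hK.norm_sub_le hy hx
  | succ k ih =>
    intro F _ _ f x₀ hf
    have hf' : ContDiffAt ℝ (k + 1 : ℕ) (fderiv ℝ f) x₀ := hf.fderiv_right (by norm_cast)
    obtain ⟨U, hU, C, hC, h⟩ := ih hf'
    have hd : ∀ᶠ z in 𝓝 x₀, DifferentiableAt ℝ f z := by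
      filter_upwards [hf.eventually (by simp)] with z hz
      exact hz.differentiableAt (by simp)
    obtain ⟨r, hr, hrU⟩ := Metric.mem_nhds_iff.1 (inter_mem hU hd)
    refine ⟨Metric.ball x₀ r, Metric.ball_mem_nhds _ hr, C, hC, fun x hx y hy hxi ↦ ?_⟩
    have h0 : fderiv ℝ f x = 0 := by
      have := norm_iteratedFDeriv_fderiv (𝕜 := ℝ) (f := f) (x := x) (n := 0)
      rw [norm_iteratedFDeriv_zero, hxi 1 le_rfl (by lia), norm_zero, norm_eq_zero] at this
      exact this
    have hseg : segment ℝ x y ⊆ Metric.ball x₀ r := (convex_ball _ _).segment_subset hx hy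
    have key := Convex.norm_image_sub_le_of_norm_hasFDerivWithin_le (𝕜 := ℝ) (f := f)
      (f' := fderiv ℝ f) (s := segment ℝ x y) (C := C * ‖y - x‖ ^ (k + 1)) (x := x) (y := y)
      (fun z hz ↦ (hrU (hseg hz)).2.hasFDerivAt.hasFDerivWithinAt) (fun z hz ↦ ?_)
      (convex_segment _ _) (left_mem_segment _ _ _) (right_mem_segment _ _ _)
    · rwa [mul_assoc, ← pow_succ] at key
    · have := h x (hrU hx).1 z (hrU (hseg hz)).1 fun i hi hik ↦ by
        rw [← norm_eq_zero, norm_iteratedFDeriv_fderiv, hxi (i + 1) (by lia) (by lia), norm_zero]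
      rw [h0, sub_zero] at this
      refine this.trans ?_
      gcongr
      obtain ⟨a, b, ha, hb, hab, rfl⟩ := hz
      have : a • x + b • y - x = b • (y - x) := by
        rw [eq_sub_of_add_eq hab]; module
      rw [this, norm_smul, Real.norm_of_nonneg hb]
      exact mul_le_of_le_one_left (norm_nonneg _) (by linarith)

/-- Where all derivatives of orders `1, …, k` vanish and `k` is at least the dimension, `f` is
Hölder of an exponent exceeding the dimension, so that the image of these points is null. -/
lemma volume_image_eq_zero_of_flat {E : Type} [NormedAddCommGroup E] [NormedSpace ℝ E]
    [FiniteDimensional ℝ E] {k : ℕ} (hk : Module.finrank ℝ E ≤ k) {f : E → ℝ} {S : Set E}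
    (hf : ∀ x ∈ S, ContDiffAt ℝ (k + 1 : ℕ) f x)
    (hS : ∀ x ∈ S, ∀ i, 1 ≤ i → i ≤ k → iteratedFDeriv ℝ i f x = 0) :
    volume (f '' S) = 0 := by
  refine volume_image_eq_zero_of_locally fun x₀ hx₀ ↦ ?_
  obtain ⟨U, hU, C, hC, h⟩ := exists_norm_sub_le_pow_of_iteratedFDeriv_eq_zero k (hf x₀ hx₀)
  refine ⟨U, hU, ?_⟩
  let _ : MeasurableSpace E := borel E
  have : BorelSpace E := ⟨rfl⟩
  have hH : HolderOnWith C.toNNReal ((k + 1 : ℕ) : NNReal) f (U ∩ S) := by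
    intro y hy x hx
    have h1 := h x hx.1 y hy.1 (hS x hx.2)
    rw [edist_eq_enorm_sub, edist_eq_enorm_sub, ← ofReal_norm, ← ofReal_norm,
      NNReal.coe_natCast, ENNReal.rpow_natCast, ← ENNReal.ofReal_pow (norm_nonneg _),
      ← ENNReal.ofReal, ← ENNReal.ofReal_mul hC]
    exact ENNReal.ofReal_le_ofReal h1
  have := hH.hausdorffMeasure_image_le (by positivity) (d := 1) zero_le_one
  rw [hausdorffMeasure_real, Real.hausdorffMeasure_of_finrank_lt (d := _ * 1)] at this
  · simpa using this
  · push_cast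
    rw [mul_one]
    exact_mod_cast Nat.lt_succ_of_le hk

/-- The inductive step in Sard's theorem: if `w` vanishes at some critical points of `f` without
being critical at `x₀`, then near `x₀` these points are critical points of the restriction of `f`
to the hypersurface `w = 0`. -/
lemma exists_volume_image_eq_zero_of_hypersurface {E : Type} [NormedAddCommGroup E]
    [NormedSpace ℝ E] [FiniteDimensional ℝ E] {N : ℕ} {f w : E → ℝ} {S : Set E} {x₀ v : E}
    (hdim : ∀ (G : Submodule ℝ E), Module.finrank ℝ G + 1 = Module.finrank ℝ E →
      ∀ (g : G → ℝ) (T : Set G), (∀ x ∈ T, ContDiffAt ℝ N g x ∧ fderiv ℝ g x = 0) →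
        volume (g '' T) = 0)
    (hf : ∀ x ∈ S, ContDiffAt ℝ (N + 1 : ℕ) f x ∧ fderiv ℝ f x = 0)
    (hw : ContDiffAt ℝ (N + 1 : ℕ) w x₀) (hwS : ∀ x ∈ S, w x = 0)
    (hv : fderiv ℝ w x₀ v ≠ 0) :
    ∃ u ∈ 𝓝 x₀, volume (f '' (u ∩ S)) = 0 := by
  set l := fderiv ℝ w x₀ with hl
  have hri : Function.RightInverse
      (ContinuousLinearMap.toSpanSingleton ℝ ((l v)⁻¹ • v)) l := by
    intro s; simp [hv]
  let L : E ≃L[ℝ] ℝ × l.ker := ContinuousLinearEquiv.equivOfRightInverse l _ hri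
  let P : E →L[ℝ] l.ker := (ContinuousLinearMap.snd ℝ ℝ l.ker).comp (L : E →L[ℝ] ℝ × l.ker)
  have hL : ((L : E ≃L[ℝ] ℝ × l.ker) : E →L[ℝ] ℝ × l.ker) = l.prod P := by
    ext x <;> simp [L, P]
  let Φ : E → ℝ × l.ker := fun x ↦ (w x, P x)
  have hΦ : ContDiffAt ℝ (N + 1 : ℕ) Φ x₀ := hw.prodMk P.contDiff.contDiffAt
  have hN : ((N + 1 : ℕ) : WithTop ℕ∞) ≠ 0 := by simp
  have hΦ' : HasFDerivAt Φ ((L : E ≃L[ℝ] ℝ × l.ker) : E →L[ℝ] ℝ × l.ker) x₀ := by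
    rw [hL]
    exact (hw.differentiableAt hN).hasFDerivAt.prodMk P.hasFDerivAt
  let g := hΦ.localInverse hΦ' hN
  have hg : ContDiffAt ℝ (N + 1 : ℕ) g (Φ x₀) := hΦ.to_localInverse hΦ' hN
  have hginv : ∀ᶠ x in 𝓝 x₀, g (Φ x) = x :=
    (hΦ.hasStrictFDerivAt' hΦ' hN).eventually_left_inverse
  have hgx : ∀ᶠ x in 𝓝 x₀, ContDiffAt ℝ (N + 1 : ℕ) g (Φ x) :=
    hΦ.continuousAt.eventually (hg.eventually (by simp))
  have hker : Module.finrank ℝ l.ker + 1 = Module.finrank ℝ E := by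
    have := L.toLinearEquiv.finrank_eq
    rw [Module.finrank_prod, Module.finrank_self] at this
    lia
  let p : l.ker → E := fun h ↦ g (0, h)
  let T : Set l.ker := {h | ContDiffAt ℝ N (f ∘ p) h ∧ fderiv ℝ (f ∘ p) h = 0}
  refine ⟨_, hginv.and hgx, measure_mono_null ?_ (hdim l.ker hker (f ∘ p) T fun x hx ↦ hx)⟩
  rintro _ ⟨x, ⟨⟨hx1, hx2⟩, hxS⟩, rfl⟩
  have hΦx : Φ x = (0, P x) := by simp [Φ, hwS x hxS]
  have hpx : p (P x) = x := by
    change g (0, P x) = x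
    rw [← hΦx]
    exact hx1
  have hp : ContDiffAt ℝ (N + 1 : ℕ) p (P x) := by
    rw [hΦx] at hx2
    exact hx2.comp (P x) (contDiffAt_const.prodMk contDiffAt_id)
  obtain ⟨hfx, hfx'⟩ := hf x hxS
  refine ⟨P x, ⟨?_, ?_⟩, by simp [hpx]⟩
  · rw [← hpx] at hfx
    exact (hfx.comp (P x) hp).of_le (by norm_cast; lia)
  · rw [← hpx] at hfx hfx'
    rw [fderiv_comp _ (hfx.differentiableAt hN) (hp.differentiableAt hN), hfx']
    simp

/-- Sard's theorem for real-valued functions, with a finite order of differentiability that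
depends only on the dimension. -/
theorem exists_forall_volume_image_critical_eq_zero (n : ℕ) :
    ∃ N : ℕ, ∀ (E : Type) [NormedAddCommGroup E] [NormedSpace ℝ E] [FiniteDimensional ℝ E],
      Module.finrank ℝ E = n → ∀ (f : E → ℝ) (S : Set E),
        (∀ x ∈ S, ContDiffAt ℝ N f x ∧ fderiv ℝ f x = 0) → volume (f '' S) = 0 := by
  induction n with
  | zero =>
    refine ⟨0, fun E _ _ _ hE f S _ ↦ ?_⟩
    have := Module.finrank_zero_iff.1 hE
    exact ((subsingleton_of_subsingleton (s := S)).image f).measure_zero volume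
  | succ n ih =>
    obtain ⟨N, hN⟩ := ih
    refine ⟨N + n + 2, fun E _ _ _ hE f S hS ↦ ?_⟩
    -- Either all derivatives up to order `n + 1` vanish, or there is a first one, of order `j + 1`,
    -- that does not; then some component of the derivative of order `j` serves as `w` above.
    let A : Set E := {x ∈ S | ∀ i, 1 ≤ i → i ≤ n + 1 → iteratedFDeriv ℝ i f x = 0}
    let B : ℕ → Set E := fun j ↦
      {x ∈ S | j ≤ n ∧ iteratedFDeriv ℝ j f x = 0 ∧ iteratedFDeriv ℝ (j + 1) f x ≠ 0}
    have hcover : S ⊆ A ∪ ⋃ j, B j := by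
      intro x hx
      by_cases hA : ∀ i, 1 ≤ i → i ≤ n + 1 → iteratedFDeriv ℝ i f x = 0
      · exact Or.inl ⟨hx, hA⟩
      · push Not at hA
        classical
        have hspec := Nat.find_spec hA
        have hmin := fun i (hi : i < Nat.find hA) ↦ Nat.find_min hA hi
        set i := Nat.find hA
        obtain ⟨hi1, hin, hi⟩ := hspec
        have h1 : iteratedFDeriv ℝ 1 f x = 0 := by
          rw [← norm_eq_zero, ← norm_iteratedFDeriv_fderiv, norm_iteratedFDeriv_zero,
            (hS x hx).2, norm_zero]
        have hi2 : i ≠ 1 := fun h ↦ hi (h ▸ h1)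
        refine Or.inr (mem_iUnion.2 ⟨i - 1, hx, by lia, ?_, ?_⟩)
        · by_contra hne
          exact hmin (i - 1) (by lia) ⟨by lia, by lia, hne⟩
        · rwa [show i - 1 + 1 = i by lia]
    refine measure_mono_null (image_mono hcover) ?_
    rw [image_union, image_iUnion]
    refine measure_union_null ?_ (measure_iUnion_null fun j ↦ ?_)
    · exact volume_image_eq_zero_of_flat hE.le
        (fun x hx ↦ (hS x hx.1).1.of_le (by norm_cast; lia)) fun x hx ↦ hx.2
    · refine volume_image_eq_zero_of_locally fun x₀ hx₀ ↦ ?_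
      obtain ⟨m, hm⟩ : ∃ m, iteratedFDeriv ℝ (j + 1) f x₀ m ≠ 0 := by
        by_contra! h
        exact hx₀.2.2.2 (ContinuousMultilinearMap.ext h)
      have hj : j ≤ n := hx₀.2.1
      have hit : ContDiffAt ℝ (N + 1 : ℕ) (iteratedFDeriv ℝ j f) x₀ :=
        (hS x₀ hx₀.1).1.iteratedFDeriv_right (by norm_cast; lia)
      let ev := ContinuousMultilinearMap.apply ℝ (fun _ : Fin j ↦ E) ℝ (Fin.tail m)
      refine exists_volume_image_eq_zero_of_hypersurface (N := N) (w := fun x ↦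
        ev (iteratedFDeriv ℝ j f x)) (v := m 0) (fun G hG g T hT ↦ hN G (by lia) g T hT)
        (fun x hx ↦ ⟨(hS x hx.1).1.of_le (by norm_cast; lia), (hS x hx.1).2⟩)
        (ev.contDiff.contDiffAt.comp x₀ hit) (fun x hx ↦ by rw [hx.2.2.1, map_zero]) ?_
      have hd : DifferentiableAt ℝ (iteratedFDeriv ℝ j f) x₀ := hit.differentiableAt (by simp)
      have : HasFDerivAt (fun x ↦ ev (iteratedFDeriv ℝ j f x))
          (ev.comp (fderiv ℝ (iteratedFDeriv ℝ j f) x₀)) x₀ :=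
        ev.hasFDerivAt.comp x₀ hd.hasFDerivAt
      rw [this.fderiv]
      rwa [iteratedFDeriv_succ_apply_left] at hm

/-- Sard's theorem for real-valued functions: the critical values form a null set. -/
theorem volume_image_critical_eq_zero {E : Type} [NormedAddCommGroup E] [NormedSpace ℝ E]
    [FiniteDimensional ℝ E] {f : E → ℝ} {S : Set E}
    (h : ∀ x ∈ S, ContDiffAt ℝ ∞ f x ∧ fderiv ℝ f x = 0) : volume (f '' S) = 0 := by
  obtain ⟨N, hN⟩ := exists_forall_volume_image_critical_eq_zero (Module.finrank ℝ E)
  exact hN E rfl f S fun x hx ↦ ⟨(h x hx).1.of_le (by exact_mod_cast le_top), (h x hx).2⟩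

/-! ### Slicing by almost isometric coordinates -/

section Slicing

variable {X Y : Type*} [EMetricSpace X] [MeasurableSpace X] [BorelSpace X]
  [EMetricSpace Y] [MeasurableSpace Y] [BorelSpace Y]

lemma euclideanHausdorffMeasure_image_le {K : NNReal} {f : X → Y} {s : Set X}
    (h : LipschitzOnWith K f s) (d : ℕ) :
    (μHE[d] : Measure Y) (f '' s) ≤ (K : ℝ≥0∞) ^ d * (μHE[d] : Measure X) s := by
  rw [Measure.euclideanHausdorffMeasure_def, Measure.euclideanHausdorffMeasure_def,
    Measure.smul_apply, Measure.smul_apply, ENNReal.smul_def, ENNReal.smul_def, smul_eq_mul,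
    smul_eq_mul, mul_left_comm]
  gcongr
  simpa using h.hausdorffMeasure_image_le (d := d) (by positivity)

lemma euclideanHausdorffMeasure_le_image {K : NNReal} {f : X → Y} {s : Set X}
    (h : ∀ x ∈ s, ∀ y ∈ s, edist x y ≤ K * edist (f x) (f y)) (d : ℕ) :
    (μHE[d] : Measure X) s ≤ (K : ℝ≥0∞) ^ d * (μHE[d] : Measure Y) (f '' s) := by
  rcases isEmpty_or_nonempty X with hX | hX
  · simp [Set.eq_empty_of_isEmpty s]
  have hinj : InjOn f s := fun x hx y hy hxy ↦ by
    have := h x hx y hy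
    rwa [hxy, edist_self, mul_zero, nonpos_iff_eq_zero, edist_eq_zero] at this
  have hL : LipschitzOnWith K (Function.invFunOn f s) (f '' s) := by
    rintro _ ⟨x, hx, rfl⟩ _ ⟨y, hy, rfl⟩
    rw [hinj.leftInvOn_invFunOn hx, hinj.leftInvOn_invFunOn hy]
    exact h x hx y hy
  have := euclideanHausdorffMeasure_image_le hL d
  rwa [hinj.invFunOn_image Subset.rfl] at this

/-- If `(a, b) : X → ℝ × ℝᵐ` distorts distances on `S` by a factor at most `r`, then the slices
`S ∩ {a = t}` integrate to at most the measure of `S`, up to powers of `r`. The bound `G` makes up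
for the possible lack of measurability of the area of the slices. -/
theorem exists_measurable_forall_slice_le {m : ℕ} {a : X → ℝ} {b : X → EuclideanSpace ℝ (Fin m)}
    {S : Set X} {r : NNReal} (hL : LipschitzOnWith r (fun y ↦ WithLp.toLp 2 (a y, b y)) S)
    (hA : ∀ y ∈ S, ∀ z ∈ S,
      edist y z ≤ r * edist (WithLp.toLp 2 (a y, b y)) (WithLp.toLp 2 (a z, b z))) :
    ∃ G : ℝ → ℝ≥0∞, Measurable G ∧ (∀ t, (μHE[m] : Measure X) (S ∩ {y | a y = t}) ≤ G t) ∧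
      ∫⁻ t, G t ≤ (r : ℝ≥0∞) ^ (2 * m + 1) * (μHE[m + 1] : Measure X) S := by
  let V := EuclideanSpace ℝ (Fin m)
  let Ψ : X → WithLp 2 (ℝ × V) := fun y ↦ WithLp.toLp 2 (a y, b y)
  have hdim : Module.finrank ℝ (WithLp 2 (ℝ × V)) = m + 1 := by
    rw [(WithLp.linearEquiv 2 ℝ (ℝ × V)).finrank_eq, Module.finrank_prod, Module.finrank_self]
    simp [V, add_comm]
  let B : Set (WithLp 2 (ℝ × V)) := toMeasurable volume (Ψ '' S)
  have hBm : MeasurableSet B := measurableSet_toMeasurable _ _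
  have hpres := WithLp.volume_preserving_toLp ℝ V
  let B' : Set (ℝ × V) := WithLp.toLp 2 ⁻¹' B
  have hB'm : MeasurableSet B' := hpres.measurable hBm
  refine ⟨fun t ↦ (r : ℝ≥0∞) ^ m * volume (Prod.mk t ⁻¹' B'),
    (measurable_measure_prodMk_left hB'm).const_mul _, fun t ↦ ?_, ?_⟩
  -- On a slice, `b` alone distorts distances by a factor at most `r`.
  · have h1 := euclideanHausdorffMeasure_le_image (K := r) (f := b) (s := S ∩ {y | a y = t})
      (fun y hy z hz ↦ by
        refine (hA y hy.1 z hz.1).trans_eq ?_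
        rw [show a y = t from hy.2, show a z = t from hz.2, edist_eq_enorm_sub, ← WithLp.toLp_sub,
          Prod.mk_sub_mk, sub_self, ← edist_zero_right, ← WithLp.toLp_zero, ← Prod.mk_zero_zero,
          WithLp.edist_toLp_snd, edist_zero_right, edist_eq_enorm_sub]) m
    refine h1.trans ?_
    rw [EuclideanSpace.euclideanHausdorffMeasure_eq_volume]
    refine mul_le_mul' le_rfl (measure_mono ?_)
    rintro _ ⟨y, ⟨hyS, hyt⟩, rfl⟩
    refine subset_toMeasurable volume (Ψ '' S) ⟨y, hyS, ?_⟩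
    simp only [Ψ, show a y = t from hyt]
  · have hB' : ∫⁻ t, volume (Prod.mk t ⁻¹' B') = volume (Ψ '' S) := by
      rw [← Measure.prod_apply hB'm, ← measure_toMeasurable (Ψ '' S),
        ← hpres.measure_preimage hBm.nullMeasurableSet]
      rfl
    rw [lintegral_const_mul _ (measurable_measure_prodMk_left hB'm), hB',
      ← InnerProductSpace.euclideanHausdorffMeasure_eq_volume, hdim,
      show 2 * m + 1 = m + (m + 1) by ring, pow_add, mul_assoc]
    gcongr
    exact euclideanHausdorffMeasure_image_le hL (m + 1)

end Slicing

/-! ### Almost isometric charts of a Riemannian manifold -/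

section Charts

variable {E : Type*} [NormedAddCommGroup E] [NormedSpace ℝ E] {H : Type*} [TopologicalSpace H]
  (I : ModelWithCorners ℝ E H) {M : Type*} [EMetricSpace M] [ChartedSpace H M] [IsManifold I 1 M]

/-- The preferred chart at `x`, viewed as a map to the tangent space at `x` by means of its
differential at `x`. -/
def tangentChart (x y : M) : TangentSpace I x :=
  (trivializationAt E (TangentSpace I) x).symmL ℝ x (extChartAt I x y)

variable [RiemannianBundle (fun x : M ↦ TangentSpace I x)]
  [IsContinuousRiemannianBundle E (fun x : M ↦ TangentSpace I x)]

variable [IsRiemannianManifold I M]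

/-- The length of a path near `x` is almost at least the distance of its endpoints in the tangent
space at `x`. -/
lemma eventually_edist_tangentChart_le (x : M) {r : NNReal} (hr : 1 < r) :
    ∃ U ∈ 𝓝 x, ∀ y ∈ U, ∀ z ∈ U,
      edist (tangentChart I x y) (tangentChart I x z) ≤ r * edist y z := by
  have h1 := eventually_norm_symmL_trivializationAt_self_comp_lt E
    (fun x : M ↦ TangentSpace I x) x (r := r) hr
  have h2 : ∀ᶠ y in 𝓝 x, y ∈ (chartAt H x).source := chart_source_mem_nhds H x
  obtain ⟨ε, hε, hball⟩ := EMetric.mem_nhds_iff.1 (h1.and h2)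
  refine ⟨Metric.eball x (ε / 3), Metric.eball_mem_nhds x
    (ENNReal.div_pos hε.ne' (by simp)), fun y hy z hz ↦ ?_⟩
  rw [← not_lt]
  intro hlt
  have hr0 : (r : ℝ≥0∞) ≠ 0 := by simpa using (zero_lt_one.trans hr).ne'
  have hd1 : edist y z < edist (tangentChart I x y) (tangentChart I x z) / r := by
    rwa [ENNReal.lt_div_iff_mul_lt (Or.inl hr0) (Or.inl ENNReal.coe_ne_top), mul_comm]
  have hy' : edist y x < ε / 3 := hy
  have hz' : edist z x < ε / 3 := hz
  have hd2 : edist y z < ε / 3 + ε / 3 :=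
    (edist_triangle_right y z x).trans_lt (ENNReal.add_lt_add hy' hz')
  -- A path of length less than `2ε / 3` from `y` to `z` does not leave the ball of radius `ε`.
  have hlt' := lt_min hd1 hd2
  rw [IsRiemannianManifold.out (I := I)] at hlt'
  obtain ⟨γ, h0, h1, hγ, hlen, -⟩ := exists_lt_locally_constant_of_riemannianEDist_lt hlt'
    zero_lt_one
  have hstay : ∀ t ∈ Icc (0 : ℝ) 1, γ t ∈ Metric.eball x ε := by
    intro t ht
    have e1 : edist (γ t) y < ε / 3 + ε / 3 := by
      rw [edist_comm, IsRiemannianManifold.out (I := I)]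
      refine ((riemannianEDist_le_pathELength hγ.contMDiffOn h0 rfl ht.1).trans
        (pathELength_mono le_rfl ht.2)).trans_lt (hlen.trans_le (min_le_right _ _))
    calc edist (γ t) x ≤ edist (γ t) y + edist y x := edist_triangle _ _ _
      _ < ε / 3 + ε / 3 + ε / 3 := ENNReal.add_lt_add e1 hy'
      _ = ε := ENNReal.add_thirds ε
  have hψγ : ∀ t ∈ Icc (0 : ℝ) 1, HasDerivAt (fun t ↦ tangentChart I x (γ t))
      ((trivializationAt E (TangentSpace I) x).symmL ℝ x
        ((trivializationAt E (TangentSpace I) x).continuousLinearMapAt ℝ (γ t)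
          (mfderiv 𝓘(ℝ, ℝ) I γ t 1))) t := by
    intro t ht
    have hsrc := (hball (hstay t ht)).2
    rw [TangentBundle.continuousLinearMapAt_trivializationAt hsrc]
    have m1 := (mdifferentiableAt_extChartAt (I := I) hsrc).hasMFDerivAt
    have m2 := (hγ.mdifferentiable one_ne_zero t).hasMFDerivAt
    have m3 := (m1.comp t m2).hasFDerivAt
    have m4 := ((trivializationAt E (TangentSpace I) x).symmL ℝ x).hasFDerivAt.comp t m3
    exact m4.hasDerivAt
  have hcd : ContDiffOn ℝ 1 (fun t ↦ tangentChart I x (γ t)) (Icc 0 1) := by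
    have c1 : ContMDiffOn 𝓘(ℝ, ℝ) 𝓘(ℝ, E) 1 (extChartAt I x ∘ γ) (Icc 0 1) :=
      contMDiffOn_extChartAt.comp (t := (chartAt H x).source) hγ.contMDiffOn
        fun t ht ↦ (hball (hstay t ht)).2
    exact ((trivializationAt E (TangentSpace I) x).symmL ℝ x).contDiff.comp_contDiffOn
      (contMDiffOn_iff_contDiffOn.1 c1)
  have hfin : edist (tangentChart I x y) (tangentChart I x z) ≤ r * pathELength I γ 0 1 := by
    rw [edist_comm, edist_eq_enorm_sub, pathELength_eq_lintegral_mfderiv_Icc, ← h0, ← h1,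
      ← lintegral_const_mul' _ _ ENNReal.coe_ne_top]
    refine (enorm_sub_le_lintegral_deriv_of_contDiffOn_Icc hcd zero_le_one).trans
      (setLIntegral_mono' measurableSet_Icc fun t ht ↦ ?_)
    rw [(hψγ t ht).deriv]
    have hn := (hball (hstay t ht)).1
    have := ContinuousLinearMap.le_of_opNorm_le _ hn.le (mfderiv 𝓘(ℝ, ℝ) I γ t 1)
    rw [← ofReal_norm, ← ofReal_norm, ← ENNReal.ofReal_coe_nnreal,
      ← ENNReal.ofReal_mul r.coe_nonneg]
    exact ENNReal.ofReal_le_ofReal this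
  have hfin' := hfin.trans_lt (ENNReal.mul_lt_mul_right hr0 ENNReal.coe_ne_top
    (hlen.trans_le (min_le_left _ _)))
  rw [ENNReal.mul_div_cancel hr0 ENNReal.coe_ne_top] at hfin'
  exact hfin'.false

/-- The segment joining two points in the chart at `x` gives a path which is almost as short as
this segment, measured in the tangent space at `x`. -/
lemma eventually_edist_le_tangentChart (x : M) {r : NNReal} (hr : 1 < r) :
    ∃ U ∈ 𝓝 x, ∀ y ∈ U, ∀ z ∈ U,
      edist y z ≤ r * edist (tangentChart I x y) (tangentChart I x z) := by
  have h1 := eventually_norm_symmL_trivializationAt_comp_self_lt E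
    (fun x : M ↦ TangentSpace I x) x (r := r) hr
  have h2 : ∀ᶠ y in 𝓝 x, y ∈ (chartAt H x).source := chart_source_mem_nhds H x
  have h3 := h1.and h2
  have hx0 : (extChartAt I x).symm (extChartAt I x x) = x := extChartAt_to_inv x
  have h4 : ∀ᶠ e in 𝓝[range I] (extChartAt I x x), e ∈ (extChartAt I x).target ∧
      (‖(trivializationAt E (TangentSpace I) x).symmL ℝ ((extChartAt I x).symm e) ∘L
        (trivializationAt E (TangentSpace I) x).continuousLinearMapAt ℝ x‖ < r ∧
        (extChartAt I x).symm e ∈ (chartAt H x).source) := by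
    refine Filter.Eventually.and (extChartAt_target_mem_nhdsWithin x) (nhdsWithin_le_nhds ?_)
    rw [← hx0] at h3
    have := (continuousAt_extChartAt_symm (I := I) x).eventually h3
    rwa [hx0] at this
  obtain ⟨ε, hε, hball⟩ := Metric.mem_nhdsWithin_iff.1 h4
  have hU : (extChartAt I x) ⁻¹' (Metric.ball (extChartAt I x x) ε ∩ range I) ∩
      (chartAt H x).source ∈ 𝓝 x := by
    refine inter_mem ?_ h2
    refine extChartAt_preimage_mem_nhds_of_mem_nhdsWithin (by simp) ?_
    rw [inter_comm]
    exact inter_mem_nhdsWithin _ (Metric.ball_mem_nhds _ hε)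
  refine ⟨_, hU, fun y hy z hz ↦ ?_⟩
  set a := extChartAt I x y with ha
  set b := extChartAt I x z with hb
  let η : ℝ → E := fun t ↦ AffineMap.lineMap a b t
  have hη : ∀ t ∈ Icc (0 : ℝ) 1, η t ∈ Metric.ball (extChartAt I x x) ε ∩ range I := by
    intro t ht
    have hc : Convex ℝ (Metric.ball (extChartAt I x x) ε ∩ range I) :=
      (convex_ball _ _).inter I.convex_range
    exact hc.segment_subset hy.1 hz.1
      (segment_eq_image_lineMap ℝ a b ▸ mem_image_of_mem _ ht)
  have hη' : ∀ t, HasDerivAt η (b - a) t := fun t ↦ AffineMap.hasDerivAt_lineMap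
  let γ : ℝ → M := fun t ↦ (extChartAt I x).symm (η t)
  have hγ : ContMDiffOn 𝓘(ℝ, ℝ) I 1 γ (Icc 0 1) := by
    refine (contMDiffOn_extChartAt_symm x).comp (t := (extChartAt I x).target) ?_
      fun t ht ↦ (hball (hη t ht)).1
    refine contMDiffOn_iff_contDiffOn.2 ?_
    have : ContDiff ℝ 1 η := (ContinuousAffineMap.lineMap (R := ℝ) a b).contDiff
    exact this.contDiffOn
  have hγ0 : γ 0 = y := by
    have : y ∈ (extChartAt I x).source := by simpa using hy.2
    simp only [γ, η, AffineMap.lineMap_apply_zero, ha, (extChartAt I x).left_inv this]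
  have hγ1 : γ 1 = z := by
    have : z ∈ (extChartAt I x).source := by simpa using hz.2
    simp only [γ, η, AffineMap.lineMap_apply_one, hb, (extChartAt I x).left_inv this]
  rw [IsRiemannianManifold.out (I := I) y z]
  refine (riemannianEDist_le_pathELength hγ hγ0 hγ1 zero_le_one).trans ?_
  rw [pathELength_eq_lintegral_mfderivWithin_Icc]
  have key : ∀ t ∈ Icc (0 : ℝ) 1, ‖mfderivWithin 𝓘(ℝ, ℝ) I γ (Icc 0 1) t 1‖ₑ ≤
      r * edist (tangentChart I x y) (tangentChart I x z) := by
    intro t ht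
    obtain ⟨ht1, ht2, ht3⟩ := hball (hη t ht)
    have m1 := (mdifferentiableWithinAt_extChartAt_symm (I := I) ht1).hasMFDerivWithinAt
    have m2 : HasMFDerivWithinAt 𝓘(ℝ, ℝ) 𝓘(ℝ, E) η (Icc 0 1) t
        (ContinuousLinearMap.toSpanSingleton ℝ (b - a)) :=
      (hη' t).hasFDerivAt.hasFDerivWithinAt.hasMFDerivWithinAt
    have m3 := m1.comp t m2 fun s hs ↦ (hη s hs).2
    have hu : UniqueMDiffWithinAt 𝓘(ℝ, ℝ) (Icc (0 : ℝ) 1) t :=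
      uniqueMDiffWithinAt_iff_uniqueDiffWithinAt.2 (uniqueDiffOn_Icc zero_lt_one t ht)
    have m4 : mfderivWithin 𝓘(ℝ, ℝ) I γ (Icc 0 1) t 1 =
        mfderivWithin 𝓘(ℝ, E) I (extChartAt I x).symm (range I) (η t) (b - a) := by
      rw [show γ = (extChartAt I x).symm ∘ η from rfl, m3.mfderivWithin hu]
      exact congrArg _ (one_smul ℝ (b - a))
    have m5 : mfderivWithin 𝓘(ℝ, E) I (extChartAt I x).symm (range I) (η t) (b - a) =
        (trivializationAt E (TangentSpace I) x).symmL ℝ (γ t) (b - a) := by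
      rw [TangentBundle.symmL_trivializationAt ht3]
      congr 2
      exact ((extChartAt I x).right_inv ht1).symm
    have m6 : b - a = (trivializationAt E (TangentSpace I) x).continuousLinearMapAt ℝ x
        (tangentChart I x z - tangentChart I x y) := by
      rw [tangentChart, tangentChart, ← map_sub]
      exact ((trivializationAt E (TangentSpace I) x).continuousLinearMapAt_symmL
        (FiberBundle.mem_baseSet_trivializationAt' x) (b - a)).symm
    rw [m4, m5, m6]
    have := ContinuousLinearMap.le_of_opNorm_le _ ht2.le
      (tangentChart I x z - tangentChart I x y)
    rw [edist_comm, edist_eq_enorm_sub, ← ofReal_norm, ← ofReal_norm,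
      ← ENNReal.ofReal_coe_nnreal, ← ENNReal.ofReal_mul r.coe_nonneg]
    exact ENNReal.ofReal_le_ofReal this
  refine (setLIntegral_mono' measurableSet_Icc key).trans ?_
  simp

end Charts

/-! ### Riemannian gradients and volume -/

section Gradient

variable {n : ℕ} {H : Type*} [TopologicalSpace H]
  (I : ModelWithCorners ℝ (EuclideanSpace ℝ (Fin n)) H)
  {M : Type*} [EMetricSpace M] [ChartedSpace H M]

instance (x : M) : FiniteDimensional ℝ (TangentSpace I x) :=
  inferInstanceAs (FiniteDimensional ℝ (EuclideanSpace ℝ (Fin n)))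

lemma finrank_tangentSpace (x : M) :
    Module.finrank ℝ (TangentSpace I x) = n :=
  finrank_euclideanSpace_fin (𝕜 := ℝ) (n := n)

lemma continuousLinearMapAt_symmL_self [IsManifold I 1 M] (x : M)
    (v : EuclideanSpace ℝ (Fin n)) :
    (trivializationAt _ (TangentSpace I) x).continuousLinearMapAt ℝ x
      ((trivializationAt _ (TangentSpace I) x).symmL ℝ x v) = v :=
  (trivializationAt _ (TangentSpace I) x).continuousLinearMapAt_symmL
    (FiberBundle.mem_baseSet_trivializationAt' x) v

lemma symmL_continuousLinearMapAt_self [IsManifold I 1 M] (x : M) (v : TangentSpace I x) :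
    (trivializationAt (EuclideanSpace ℝ (Fin n)) (TangentSpace I) x).symmL ℝ x
      ((trivializationAt (EuclideanSpace ℝ (Fin n)) (TangentSpace I) x).continuousLinearMapAt ℝ x
        v) = v :=
  (trivializationAt _ (TangentSpace I) x).symmL_continuousLinearMapAt
    (FiberBundle.mem_baseSet_trivializationAt' x) v

/-- The differential of a real-valued function, typed as a linear form to `ℝ` itself rather than to
a tangent space of `ℝ`. -/
def differential (f : M → ℝ) (x : M) : TangentSpace I x →L[ℝ] ℝ := mfderiv I 𝓘(ℝ, ℝ) f x

variable [RiemannianBundle (fun x : M ↦ TangentSpace I x)]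

lemma inner_riemannianGradient (f : M → ℝ) (x : M) (v : TangentSpace I x) :
    inner ℝ (riemannianGradient I f x) v = differential I f x v :=
  InnerProductSpace.toDual_symm_apply

lemma riemannianGradient_neg (f : M → ℝ) (x : M) :
    riemannianGradient I (fun y ↦ -f y) x = -riemannianGradient I f x := by
  refine ext_inner_right ℝ fun v ↦ ?_
  rw [inner_neg_left, inner_riemannianGradient, inner_riemannianGradient]
  exact congrArg (fun L : TangentSpace I x →L[ℝ] ℝ ↦ L v) (mfderiv_neg (f := f) (x := x))

lemma riemannianGradient_sub_const {f : M → ℝ} {x : M} (hf : MDifferentiableAt I 𝓘(ℝ, ℝ) f x)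
    (c : ℝ) : riemannianGradient I (fun y ↦ f y - c) x = riemannianGradient I f x := by
  refine ext_inner_right ℝ fun v ↦ ?_
  rw [inner_riemannianGradient, inner_riemannianGradient]
  have h := (hf.hasMFDerivAt.sub (hasMFDerivAt_const c x)).mfderiv
  have h' : differential I (fun y ↦ f y - c) x = differential I f x - 0 := h
  rw [h', sub_zero]

lemma riemannianGradient_eq_zero_iff {f : M → ℝ} {x : M} :
    riemannianGradient I f x = 0 ↔ mfderiv I 𝓘(ℝ, ℝ) f x = 0 := by
  rw [riemannianGradient]
  exact LinearIsometryEquiv.map_eq_zero_iff _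

variable [IsManifold I 1 M]
  [IsContinuousRiemannianBundle (EuclideanSpace ℝ (Fin n)) (fun x : M ↦ TangentSpace I x)]

/-- Lower semicontinuity suffices for measurability and for the lower bound on `|∇f|` near a given
point which the coarea inequality needs. -/
lemma lowerSemicontinuous_norm_riemannianGradient {f : M → ℝ}
    (hf : ContMDiff I 𝓘(ℝ, ℝ) 1 f) : LowerSemicontinuous fun x ↦ ‖riemannianGradient I f x‖ := by
  intro x a ha
  rcases lt_or_ge a 0 with ha0 | ha0
  · exact Eventually.of_forall fun y ↦ ha0.trans_le (norm_nonneg _)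
  -- The vector `∇f(x)`, transported to nearby points, tests the size of `df` there.
  set v := riemannianGradient I f x with hv
  have hv0 : 0 < ‖v‖ := ha0.trans_lt ha
  let e := trivializationAt (EuclideanSpace ℝ (Fin n)) (TangentSpace I) x
  let w : EuclideanSpace ℝ (Fin n) := e.continuousLinearMapAt ℝ x v
  obtain ⟨r, hr1, hr⟩ : ∃ r : ℝ, 1 < r ∧ a * r < ‖v‖ := by
    have h : Tendsto (fun r : ℝ ↦ a * r) (𝓝[>] 1) (𝓝 (a * 1)) :=
      ((continuous_const.mul continuous_id).tendsto 1).mono_left nhdsWithin_le_nhds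
    have h' : ∀ᶠ r in 𝓝[>] (1 : ℝ), 1 < r := self_mem_nhdsWithin
    exact (h'.and (h.eventually_lt_const (by simpa using ha))).exists
  have hcont : ContinuousAt (fun y ↦ differential I f y (e.symmL ℝ y w)) x := by
    have h1 := (((hf x).mfderiv_const (m := 0) (by simp)).continuousAt).clm_apply
      (continuousAt_const (y := w))
    refine h1.congr (Eventually.of_forall fun y ↦ ?_)
    simp only [inTangentCoordinates, ContinuousLinearMap.inCoordinates,
      TangentBundle.continuousLinearMapAt_model_space]
    rfl
  have hx : differential I f x (e.symmL ℝ x w) = ‖v‖ ^ 2 := by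
    rw [← inner_riemannianGradient, ← real_inner_self_eq_norm_sq,
      symmL_continuousLinearMapAt_self]
  have h2 : ∀ᶠ y in 𝓝 x, a * (r * ‖v‖) <
      differential I f y (e.symmL ℝ y w) := by
    refine hcont.eventually_const_lt (lt_of_lt_of_eq ?_ hx.symm)
    nlinarith
  filter_upwards [h2, eventually_norm_symmL_trivializationAt_comp_self_lt
    (EuclideanSpace ℝ (Fin n)) (fun x : M ↦ TangentSpace I x) x hr1] with y hy1 hy2
  have hy3 : ‖e.symmL ℝ y w‖ ≤ r * ‖v‖ := ContinuousLinearMap.le_of_opNorm_le _ hy2.le v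
  rw [← inner_riemannianGradient] at hy1
  have hy4 := real_inner_le_norm (riemannianGradient I f y) (e.symmL ℝ y w)
  have hy5 : ‖riemannianGradient I f y‖ * ‖e.symmL ℝ y w‖ ≤
      ‖riemannianGradient I f y‖ * (r * ‖v‖) := by gcongr
  exact lt_of_mul_lt_mul_right (hy1.trans_le (hy4.trans hy5)) (by positivity)

variable [IsRiemannianManifold I M]

lemma eventually_tangentChart_bilipschitz (x : M) {r : NNReal} (hr : 1 < r) :
    ∃ U ∈ 𝓝 x, ∀ y ∈ U, ∀ z ∈ U,
      edist (tangentChart I x y) (tangentChart I x z) ≤ r * edist y z ∧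
      edist y z ≤ r * edist (tangentChart I x y) (tangentChart I x z) := by
  obtain ⟨U, hU, h1⟩ := eventually_edist_tangentChart_le I x hr
  obtain ⟨V, hV, h2⟩ := eventually_edist_le_tangentChart I x hr
  exact ⟨U ∩ V, inter_mem hU hV, fun y hy z hz ↦ ⟨h1 y hy.1 z hz.1, h2 y hy.2 z hz.2⟩⟩

end Gradient

/-- The Riemannian volume of a compact manifold, possibly with boundary, is finite. -/
lemma isFiniteMeasure_riemannianVolume {n : ℕ} {H : Type*} [TopologicalSpace H]
    (I : ModelWithCorners ℝ (EuclideanSpace ℝ (Fin n)) H) {M : Type*} [EMetricSpace M]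
    [ChartedSpace H M] [IsManifold I 1 M] [RiemannianBundle (fun x : M ↦ TangentSpace I x)]
    [IsContinuousRiemannianBundle (EuclideanSpace ℝ (Fin n)) (fun x : M ↦ TangentSpace I x)]
    [IsRiemannianManifold I M] [CompactSpace M] [MeasurableSpace M] [BorelSpace M] :
    IsFiniteMeasure (μHE[n] : Measure M) := by
  have : IsLocallyFiniteMeasure (μHE[n] : Measure M) := by
    refine ⟨fun x ↦ ?_⟩
    obtain ⟨U, hU, h⟩ := eventually_tangentChart_bilipschitz I x (r := 2) (by norm_num)
    have hx : x ∈ U := mem_of_mem_nhds hU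
    refine ⟨U ∩ Metric.eball x 1, inter_mem hU (Metric.eball_mem_nhds _ one_pos), ?_⟩
    let _ : MeasurableSpace (TangentSpace I x) := borel _
    have _ : BorelSpace (TangentSpace I x) := ⟨rfl⟩
    refine (euclideanHausdorffMeasure_le_image (K := 2) (f := tangentChart I x)
      (fun y hy z hz ↦ (h y hy.1 z hz.1).2) n).trans_lt ?_
    have hb : tangentChart I x '' (U ∩ Metric.eball x 1) ⊆
        Metric.closedBall (tangentChart I x x) 2 := by
      rintro _ ⟨y, hy, rfl⟩
      rw [← Metric.closedEBall_ofReal (by norm_num)]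
      have h1 : edist y x ≤ 1 := le_of_lt hy.2
      calc edist (tangentChart I x y) (tangentChart I x x) ≤ (2 : NNReal) * edist y x :=
            (h y hy.1 x hx).1
        _ ≤ (2 : NNReal) * 1 := by gcongr
        _ = ENNReal.ofReal 2 := by simp
    have hfin : (μHE[n] : Measure (TangentSpace I x))
        (tangentChart I x '' (U ∩ Metric.eball x 1)) < ⊤ := by
      have := isAddHaarMeasure_euclideanHausdorffMeasure (E := TangentSpace I x)
      rw [finrank_tangentSpace] at this
      have : ProperSpace (TangentSpace I x) := FiniteDimensional.proper ℝ _
      exact (Metric.isBounded_closedBall.subset hb).measure_lt_top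
    exact ENNReal.mul_lt_top (by simp) hfin
  infer_instance

/-! ### The coarea inequality -/

/-- A unit vector `e` is the first vector of an orthonormal frame, written as an isometry
`v ↦ (⟪e, v⟫, P v)`. -/
lemma exists_norm_toLp_inner_eq {m : ℕ} {T : Type*} [NormedAddCommGroup T] [InnerProductSpace ℝ T]
    [FiniteDimensional ℝ T] (hT : Module.finrank ℝ T = m + 1) {e : T} (he : ‖e‖ = 1) :
    ∃ P : T →L[ℝ] EuclideanSpace ℝ (Fin m), ∀ v, ‖WithLp.toLp 2 (inner ℝ e v, P v)‖ = ‖v‖ := by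
  have : Fact (Module.finrank ℝ T = m + 1) := ⟨hT⟩
  have he0 : e ≠ 0 := by rintro rfl; simp at he
  have hK : Module.finrank ℝ (ℝ ∙ e)ᗮ = m := Submodule.finrank_orthogonal_span_singleton he0
  let J := ((stdOrthonormalBasis ℝ (ℝ ∙ e)ᗮ).reindex (finCongr hK)).repr
  refine ⟨(J : (ℝ ∙ e)ᗮ →L[ℝ] EuclideanSpace ℝ (Fin m)).comp
    (ℝ ∙ e)ᗮ.orthogonalProjectionOnto, fun v ↦ ?_⟩
  rw [← sq_eq_sq₀ (norm_nonneg _) (norm_nonneg _), WithLp.prod_norm_sq_eq_of_L2,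
    Submodule.norm_sq_eq_add_norm_sq_projection v (ℝ ∙ e)]
  congr 2
  · have h := congrArg norm (Submodule.starProjection_unit_singleton ℝ he v)
    rw [norm_smul, he, mul_one] at h
    exact h.symm
  · exact J.norm_map _

section Local

variable {n : ℕ} {H : Type*} [TopologicalSpace H]
  (I : ModelWithCorners ℝ (EuclideanSpace ℝ (Fin n)) H)
  {M : Type*} [EMetricSpace M] [ChartedSpace H M]
  [RiemannianBundle (fun x : M ↦ TangentSpace I x)] [IsManifold I 1 M]

/-- At an interior point, a `C¹` function is strictly differentiable in the tangent chart. -/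
lemma eventually_abs_sub_differential_le {f : M → ℝ} (hf : ContMDiff I 𝓘(ℝ, ℝ) 1 f) {x : M}
    (hx : I.IsInteriorPoint x) {κ : ℝ} (hκ : 0 < κ) :
    ∃ U ∈ 𝓝 x, ∀ y ∈ U, ∀ z ∈ U,
      |f y - f z - differential I f x (tangentChart I x y - tangentChart I x z)| ≤
        κ * ‖tangentChart I x y - tangentChart I x z‖ := by
  let e := trivializationAt (EuclideanSpace ℝ (Fin n)) (TangentSpace I) x
  let A := e.continuousLinearMapAt ℝ x
  let F : EuclideanSpace ℝ (Fin n) → ℝ := f ∘ (extChartAt I x).symm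
  have hF : ContDiffAt ℝ 1 F (extChartAt I x x) := by
    have := (contMDiffAt_iff.1 (hf x)).2
    exact this.contDiffAt (mem_interior_iff_mem_nhds.1 hx)
  have hFs := hF.hasStrictFDerivAt one_ne_zero
  have hsrc : x ∈ (chartAt H x).source := mem_chart_source H x
  -- `f` is `F` read in the chart, so that `df = dF ∘ dφ`, where `φ` is the chart.
  have hD : ∀ w, fderiv ℝ F (extChartAt I x x) (A w) = differential I f x w := by
    intro w
    have m1 := (mdifferentiableAt_extChartAt (I := I) hsrc).hasMFDerivAt
    have m2 := (hFs.hasFDerivAt.hasMFDerivAt).comp x m1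
    have heq : f =ᶠ[𝓝 x] F ∘ extChartAt I x := by
      filter_upwards [extChartAt_source_mem_nhds (I := I) x] with y hy
      simp only [F, Function.comp_apply, (extChartAt I x).left_inv hy]
    have m3 := (m2.congr_of_eventuallyEq heq).mfderiv
    have m4 : differential I f x =
        (fderiv ℝ F (extChartAt I x x)).comp (mfderiv I 𝓘(ℝ, _) (extChartAt I x) x) := m3
    rw [m4, ← TangentBundle.continuousLinearMapAt_trivializationAt hsrc]
    rfl
  have hAψ : ∀ y, A (tangentChart I x y) = extChartAt I x y := fun y ↦
    continuousLinearMapAt_symmL_self I x _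
  have hC : 0 < ‖A‖ + 1 := by positivity
  have hlo := hFs.isLittleO.def (div_pos hκ hC)
  rw [nhds_prod_eq] at hlo
  have hchart := continuousAt_extChartAt (I := I) x
  obtain ⟨V, hV, hVlo⟩ := Filter.mem_prod_self_iff.1 hlo
  refine ⟨extChartAt I x ⁻¹' V ∩ (extChartAt I x).source,
    inter_mem (hchart hV) (extChartAt_source_mem_nhds x), fun y hy z hz ↦ ?_⟩
  have h := hVlo (mk_mem_prod hy.1 hz.1)
  have hy' : F (extChartAt I x y) = f y := congrArg f ((extChartAt I x).left_inv hy.2)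
  have hz' : F (extChartAt I x z) = f z := congrArg f ((extChartAt I x).left_inv hz.2)
  have hΔ : extChartAt I x y - extChartAt I x z =
      A (tangentChart I x y - tangentChart I x z) := by rw [map_sub, hAψ, hAψ]
  simp only [mem_ofPred_eq, hy', hz', hΔ, hD] at h
  refine h.trans ?_
  have h2 := A.le_opNorm (tangentChart I x y - tangentChart I x z)
  rw [div_mul_eq_mul_div, div_le_iff₀ hC, mul_assoc]
  gcongr
  refine h2.trans ?_
  rw [mul_comm]
  gcongr
  linarith

variable [IsRiemannianManifold I M]
  [IsContinuousRiemannianBundle (EuclideanSpace ℝ (Fin n)) (fun x : M ↦ TangentSpace I x)]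

/-- Near an interior point which is not critical for `f`, the function `f` is, up to scaling, the
first of `n` almost isometric coordinates. Slicing in these coordinates gives the local form of the
coarea inequality. -/
lemma exists_nhds_slice_le [MeasurableSpace M] [BorelSpace M] {m : ℕ} (hn : n = m + 1) {f : M → ℝ}
    (hf : ContMDiff I 𝓘(ℝ, ℝ) 1 f) {x : M} (hx : I.IsInteriorPoint x)
    (hx0 : riemannianGradient I f x ≠ 0) {r : NNReal} (hr : 1 < r) :
    ∃ U ∈ 𝓝 x, ∀ S ⊆ U, ∃ G : ℝ → ℝ≥0∞, Measurable G ∧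
      (∀ t, (μHE[m] : Measure M) (S ∩ {y | f y = t}) ≤ G t) ∧
      ∫⁻ t, G t ≤ ‖riemannianGradient I f x‖ₑ *
        ((r : ℝ≥0∞) ^ (2 * m + 1) * (μHE[n] : Measure M) S) := by
  set c := ‖riemannianGradient I f x‖ with hc
  have hc0 : 0 < c := norm_pos_iff.2 hx0
  let e : TangentSpace I x := c⁻¹ • riemannianGradient I f x
  have he : ‖e‖ = 1 := by rw [norm_smul, norm_inv, norm_norm, ← hc, inv_mul_cancel₀ hc0.ne']
  have hde : ∀ v, differential I f x v = c * inner ℝ e v := by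
    intro v
    rw [real_inner_smul_left, inner_riemannianGradient, mul_inv_cancel_left₀ hc0.ne']
  obtain ⟨P, hP⟩ := exists_norm_toLp_inner_eq ((finrank_tangentSpace I x).trans hn) he
  -- `s = √r` is the distortion allowed for the chart, and again for straightening `f`.
  let s : NNReal := NNReal.sqrt r
  have hs : 1 < s := by simpa [s] using NNReal.sqrt_lt_sqrt.2 hr
  have hss : s * s = r := NNReal.mul_self_sqrt r
  have hs' : (1 : ℝ) < s := by exact_mod_cast hs
  have hs0 : (0 : ℝ) < s := by linarith
  let δ : ℝ := 1 - (s : ℝ)⁻¹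
  have hδ : 0 < δ := sub_pos.2 (inv_lt_one_of_one_lt₀ hs')
  have hδs : 1 + δ ≤ s := by
    have : 0 ≤ (s : ℝ)⁻¹ * ((s : ℝ) - 1) ^ 2 := by positivity
    have h2 : (s : ℝ)⁻¹ * ((s : ℝ) - 1) ^ 2 = s - 2 + (s : ℝ)⁻¹ := by field_simp; ring
    simp only [δ]; linarith
  obtain ⟨U, hU, hUψ⟩ := eventually_tangentChart_bilipschitz I x hs
  obtain ⟨V, hV, hVf⟩ := eventually_abs_sub_differential_le I hf hx (mul_pos hc0 hδ)
  let a : M → ℝ := fun y ↦ c⁻¹ * f y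
  let b : M → EuclideanSpace ℝ (Fin m) := fun y ↦ P (tangentChart I x y)
  have hclose : ∀ y ∈ V, ∀ z ∈ V,
      |‖WithLp.toLp 2 (a y, b y) - WithLp.toLp 2 (a z, b z)‖ -
        ‖tangentChart I x y - tangentChart I x z‖| ≤
          δ * ‖tangentChart I x y - tangentChart I x z‖ := by
    intro y hy z hz
    set Δ := tangentChart I x y - tangentChart I x z with hΔ
    have h := hVf y hy z hz
    rw [← hΔ, hde, mul_assoc] at h
    have h1 : |a y - a z - inner ℝ e Δ| ≤ δ * ‖Δ‖ := by
      have : a y - a z - inner ℝ e Δ = c⁻¹ * (f y - f z - c * inner ℝ e Δ) := by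
        simp only [a]; field_simp
      rw [this, abs_mul, abs_of_pos (inv_pos.2 hc0), inv_mul_le_iff₀ hc0]
      exact h
    rw [← hP Δ]
    refine (abs_norm_sub_norm_le _ _).trans ?_
    have h2 : WithLp.toLp 2 (a y, b y) - WithLp.toLp 2 (a z, b z) -
        WithLp.toLp 2 (inner ℝ e Δ, P Δ) =
        WithLp.toLp 2 (a y - a z - inner ℝ e Δ, (0 : EuclideanSpace ℝ (Fin m))) := by
      rw [← WithLp.toLp_sub, ← WithLp.toLp_sub, Prod.mk_sub_mk, Prod.mk_sub_mk, hΔ, map_sub,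
        sub_self]
    rw [h2, WithLp.norm_toLp_fst, hP]
    exact h1
  have hup : ∀ y ∈ V, ∀ z ∈ V, edist (WithLp.toLp 2 (a y, b y)) (WithLp.toLp 2 (a z, b z)) ≤
      s * edist (tangentChart I x y) (tangentChart I x z) := by
    intro y hy z hz
    have h := (abs_le.1 (hclose y hy z hz)).2
    rw [edist_eq_enorm_sub, edist_eq_enorm_sub, ← ofReal_norm, ← ofReal_norm,
      ← ENNReal.ofReal_coe_nnreal, ← ENNReal.ofReal_mul s.coe_nonneg]
    refine ENNReal.ofReal_le_ofReal ?_
    nlinarith [norm_nonneg (tangentChart I x y - tangentChart I x z)]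
  have hlow : ∀ y ∈ V, ∀ z ∈ V, edist (tangentChart I x y) (tangentChart I x z) ≤
      s * edist (WithLp.toLp 2 (a y, b y)) (WithLp.toLp 2 (a z, b z)) := by
    intro y hy z hz
    have h := (abs_le.1 (hclose y hy z hz)).1
    rw [edist_eq_enorm_sub, edist_eq_enorm_sub, ← ofReal_norm, ← ofReal_norm,
      ← ENNReal.ofReal_coe_nnreal, ← ENNReal.ofReal_mul s.coe_nonneg]
    refine ENNReal.ofReal_le_ofReal ?_
    rw [← inv_mul_le_iff₀ hs0]
    simp only [δ] at h
    linarith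
  refine ⟨U ∩ V, inter_mem hU hV, fun S hS ↦ ?_⟩
  obtain ⟨G, hGm, hG, hGint⟩ := exists_measurable_forall_slice_le (a := a) (b := b) (S := S)
    (r := r) (fun y hy z hz ↦ by
      refine (hup y (hS hy).2 z (hS hz).2).trans ?_
      rw [← hss, ENNReal.coe_mul, mul_assoc]
      gcongr
      exact (hUψ y (hS hy).1 z (hS hz).1).1) (fun y hy z hz ↦ by
      refine (hUψ y (hS hy).1 z (hS hz).1).2.trans ?_
      rw [← hss, ENNReal.coe_mul, mul_assoc]
      gcongr
      exact hlow y (hS hy).2 z (hS hz).2)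
  refine ⟨fun t ↦ G (c⁻¹ * t), hGm.comp (measurable_const_mul _), fun t ↦ ?_, ?_⟩
  · refine (measure_mono fun y hy ↦ ?_).trans (hG _)
    exact ⟨hy.1, congrArg (c⁻¹ * ·) hy.2⟩
  · rw [← lintegral_map hGm (measurable_const_mul _),
      Real.map_volume_mul_left (inv_ne_zero hc0.ne'),
      inv_inv, abs_of_pos hc0, lintegral_smul_measure, smul_eq_mul, hc, ofReal_norm]
    rw [← hn] at hGint
    gcongr

/-- The coarea inequality: the weighted areas of the level sets of `f`, away from the boundary and
from the critical points of `f`, integrate to at most `∫ w |∇f|`. The set `A` of these points need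
not be measurable, hence the measurable `B ⊇ A`. -/
theorem lintegral_levelSet_le [SecondCountableTopology M] [MeasurableSpace M] [BorelSpace M]
    {m : ℕ} (hn : n = m + 1) {f w : M → ℝ} (hf : ContMDiff I 𝓘(ℝ, ℝ) 1 f) (hw : Continuous w)
    {A B : Set M} (hAB : A ⊆ B) (hB : MeasurableSet B)
    (hA : ∀ x ∈ A, I.IsInteriorPoint x ∧ riemannianGradient I f x ≠ 0 ∧ 0 < w x) :
    ∫⁻ t, ∫⁻ y in A ∩ {y | f y = t}, ENNReal.ofReal (w y) ∂(μHE[m] : Measure M) ≤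
      ∫⁻ y in B, ENNReal.ofReal (w y) * ‖riemannianGradient I f y‖ₑ ∂(μHE[n] : Measure M) := by
  set X := ∫⁻ y in B, ENNReal.ofReal (w y) * ‖riemannianGradient I f y‖ₑ ∂(μHE[n] : Measure M)
    with hX
  suffices h : ∀ r : NNReal, 1 < r →
      ∫⁻ t, ∫⁻ y in A ∩ {y | f y = t}, ENNReal.ofReal (w y) ∂(μHE[m] : Measure M) ≤
        (r : ℝ≥0∞) ^ (2 * m + 4) * X by
    have hlim : Tendsto (fun r : NNReal ↦ (r : ℝ≥0∞) ^ (2 * m + 4) * X) (𝓝[>] 1) (𝓝 X) := by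
      have h1 : Tendsto (fun r : NNReal ↦ (r : ℝ≥0∞) ^ (2 * m + 4)) (𝓝[>] 1) (𝓝 1) := by
        have : Tendsto (fun r : NNReal ↦ ((r ^ (2 * m + 4) : NNReal) : ℝ≥0∞)) (𝓝 1)
            (𝓝 (((1 : NNReal) ^ (2 * m + 4) : NNReal) : ℝ≥0∞)) :=
          (ENNReal.continuous_coe.comp (continuous_pow _)).tendsto 1
        simpa using this.mono_left nhdsWithin_le_nhds
      simpa using ENNReal.Tendsto.mul_const (b := X) h1 (Or.inl one_ne_zero)
    exact ge_of_tendsto hlim (by filter_upwards [self_mem_nhdsWithin] with r hr using h r hr)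
  intro r hr
  have hr' : (1 : ℝ) < r := by exact_mod_cast hr
  have hloc : ∀ x ∈ A, ∃ U, IsOpen U ∧ x ∈ U ∧ (∀ S ⊆ U, ∃ G : ℝ → ℝ≥0∞, Measurable G ∧
      (∀ t, (μHE[m] : Measure M) (S ∩ {y | f y = t}) ≤ G t) ∧
      ∫⁻ t, G t ≤ ‖riemannianGradient I f x‖ₑ *
        ((r : ℝ≥0∞) ^ (2 * m + 1) * (μHE[n] : Measure M) S)) ∧
      ∀ y ∈ U, w y ≤ r * w x ∧ w x ≤ r * w y ∧
        ‖riemannianGradient I f x‖ ≤ r * ‖riemannianGradient I f y‖ := by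
    intro x hx
    obtain ⟨hint, hgrad, hpos⟩ := hA x hx
    obtain ⟨U, hU, hUG⟩ := exists_nhds_slice_le I hn hf hint hgrad hr
    have h1 : ∀ᶠ y in 𝓝 x, w y < r * w x :=
      hw.continuousAt.eventually_lt_const (by nlinarith)
    have h2 : ∀ᶠ y in 𝓝 x, w x < r * w y :=
      (continuous_const.mul hw).continuousAt.eventually_const_lt
        (by change w x < r * w x; nlinarith)
    have h3 : ∀ᶠ y in 𝓝 x, ‖riemannianGradient I f x‖ / r < ‖riemannianGradient I f y‖ :=
      lowerSemicontinuous_norm_riemannianGradient I hf x _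
        (div_lt_self (norm_pos_iff.2 hgrad) hr')
    obtain ⟨V, hV, hVo, hxV⟩ := mem_nhds_iff.1 (inter_mem hU (h1.and (h2.and h3)))
    refine ⟨V, hVo, hxV, fun S hS ↦ hUG S fun y hy ↦ (hV (hS hy)).1, fun y hy ↦ ?_⟩
    obtain ⟨-, h1, h2, h3⟩ := hV hy
    refine ⟨h1.le, h2.le, ?_⟩
    rw [div_lt_iff₀ (by linarith)] at h3
    linarith
  rcases A.eq_empty_or_nonempty with hAe | hAe
  · simp [hAe]
  choose! U hUo hxU hUG hUw using hloc
  obtain ⟨T, hTA, hTc, hT⟩ := TopologicalSpace.countable_cover_nhdsWithin (f := U) (s := A)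
    fun x hx ↦ mem_nhdsWithin_of_mem_nhds ((hUo x hx).mem_nhds (hxU x hx))
  have hTne : T.Nonempty := by
    obtain ⟨x, hx⟩ := hAe
    obtain ⟨z, hz, -⟩ := mem_iUnion₂.1 (hT hx)
    exact ⟨z, hz⟩
  obtain ⟨g, rfl⟩ := hTc.exists_eq_range hTne
  have hgA : ∀ k, g k ∈ A := fun k ↦ hTA (mem_range_self k)
  -- Cut `A` into countably many pieces, on which `w` and `|∇f|` are almost constant.
  let S : ℕ → Set M := fun k ↦ disjointed (fun k ↦ U (g k)) k ∩ B
  have hSU : ∀ k, S k ⊆ U (g k) := fun k y hy ↦ disjointed_subset _ k hy.1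
  have hSm : ∀ k, MeasurableSet (S k) := fun k ↦
    (MeasurableSet.disjointed (fun k ↦ (hUo _ (hgA k)).measurableSet) k).inter hB
  have hSd : Pairwise (Function.onFun Disjoint S) := fun i j hij ↦
    (disjoint_disjointed _ hij).mono inter_subset_left inter_subset_left
  have hAS : A ⊆ ⋃ k, S k := by
    intro x hx
    have h1 : x ∈ ⋃ k, disjointed (fun k ↦ U (g k)) k := by
      rw [iUnion_disjointed]
      simpa using hT hx
    obtain ⟨k, hk⟩ := mem_iUnion.1 h1
    exact mem_iUnion.2 ⟨k, hk, hAB hx⟩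
  choose G hGm hG hGint using fun k ↦ hUG (g k) (hgA k) (S k) (hSU k)
  have hpt : ∀ t, ∫⁻ y in A ∩ {y | f y = t}, ENNReal.ofReal (w y) ∂(μHE[m] : Measure M) ≤
      ∑' k, ENNReal.ofReal (r * w (g k)) * G k t := by
    intro t
    calc ∫⁻ y in A ∩ {y | f y = t}, ENNReal.ofReal (w y) ∂(μHE[m] : Measure M)
        ≤ ∫⁻ y in ⋃ k, (S k ∩ {y | f y = t}), ENNReal.ofReal (w y) ∂(μHE[m] : Measure M) := by
          refine lintegral_mono_set ?_
          rw [← iUnion_inter]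
          exact inter_subset_inter_left _ hAS
      _ ≤ ∑' k, ∫⁻ y in S k ∩ {y | f y = t}, ENNReal.ofReal (w y) ∂(μHE[m] : Measure M) :=
          lintegral_iUnion_le _ _
      _ ≤ ∑' k, ENNReal.ofReal (r * w (g k)) * G k t := by
          refine ENNReal.tsum_le_tsum fun k ↦ ?_
          have hmeas : MeasurableSet (S k ∩ {y | f y = t}) :=
            (hSm k).inter (hf.continuous.measurable (measurableSet_singleton t))
          calc ∫⁻ y in S k ∩ {y | f y = t}, ENNReal.ofReal (w y) ∂(μHE[m] : Measure M)
              ≤ ∫⁻ _ in S k ∩ {y | f y = t}, ENNReal.ofReal (r * w (g k))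
                  ∂(μHE[m] : Measure M) :=
                setLIntegral_mono' hmeas fun y hy ↦
                  ENNReal.ofReal_le_ofReal (hUw _ (hgA k) y (hSU k hy.1)).1
            _ ≤ _ := by
                rw [setLIntegral_const]
                exact mul_le_mul' le_rfl (hG k t)
  have hk : ∀ k, ENNReal.ofReal (r * w (g k)) * ∫⁻ t, G k t ≤ (r : ℝ≥0∞) ^ (2 * m + 4) *
      ∫⁻ y in S k, ENNReal.ofReal (w y) * ‖riemannianGradient I f y‖ₑ ∂(μHE[n] : Measure M) := by
    intro k
    have hconst : ENNReal.ofReal (w (g k)) * ‖riemannianGradient I f (g k)‖ₑ *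
        (μHE[n] : Measure M) (S k) ≤ (r : ℝ≥0∞) ^ 2 * ∫⁻ y in S k,
          ENNReal.ofReal (w y) * ‖riemannianGradient I f y‖ₑ ∂(μHE[n] : Measure M) := by
      rw [← setLIntegral_const, ← lintegral_const_mul' _ _ (by simp)]
      refine setLIntegral_mono' (hSm k) fun y hy ↦ ?_
      obtain ⟨-, h2, h3⟩ := hUw _ (hgA k) y (hSU k hy)
      calc ENNReal.ofReal (w (g k)) * ‖riemannianGradient I f (g k)‖ₑ
          ≤ ENNReal.ofReal (r * w y) * ENNReal.ofReal (r * ‖riemannianGradient I f y‖) := by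
            rw [← ofReal_norm]
            gcongr
        _ = _ := by
            rw [ENNReal.ofReal_mul r.coe_nonneg, ENNReal.ofReal_mul r.coe_nonneg,
              ENNReal.ofReal_coe_nnreal, ofReal_norm]
            ring
    calc ENNReal.ofReal (r * w (g k)) * ∫⁻ t, G k t
        ≤ (r * ENNReal.ofReal (w (g k))) * (‖riemannianGradient I f (g k)‖ₑ *
          ((r : ℝ≥0∞) ^ (2 * m + 1) * (μHE[n] : Measure M) (S k))) := by
          rw [ENNReal.ofReal_mul r.coe_nonneg, ENNReal.ofReal_coe_nnreal]
          exact mul_le_mul' le_rfl (hGint k)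
      _ = (r : ℝ≥0∞) ^ (2 * m + 2) * (ENNReal.ofReal (w (g k)) *
          ‖riemannianGradient I f (g k)‖ₑ * (μHE[n] : Measure M) (S k)) := by ring
      _ ≤ (r : ℝ≥0∞) ^ (2 * m + 2) * _ := mul_le_mul' le_rfl hconst
      _ = _ := by ring
  calc ∫⁻ t, ∫⁻ y in A ∩ {y | f y = t}, ENNReal.ofReal (w y) ∂(μHE[m] : Measure M)
      ≤ ∫⁻ t, ∑' k, ENNReal.ofReal (r * w (g k)) * G k t := lintegral_mono hpt
    _ = ∑' k, ENNReal.ofReal (r * w (g k)) * ∫⁻ t, G k t := by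
        rw [lintegral_tsum fun k ↦ ((hGm k).const_mul _).aemeasurable]
        exact tsum_congr fun k ↦ lintegral_const_mul _ (hGm k)
    _ ≤ ∑' k, (r : ℝ≥0∞) ^ (2 * m + 4) * ∫⁻ y in S k,
          ENNReal.ofReal (w y) * ‖riemannianGradient I f y‖ₑ ∂(μHE[n] : Measure M) :=
        ENNReal.tsum_le_tsum hk
    _ = (r : ℝ≥0∞) ^ (2 * m + 4) * ∫⁻ y in ⋃ k, S k,
          ENNReal.ofReal (w y) * ‖riemannianGradient I f y‖ₑ ∂(μHE[n] : Measure M) := by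
        rw [ENNReal.tsum_mul_left, lintegral_iUnion hSm hSd]
    _ ≤ (r : ℝ≥0∞) ^ (2 * m + 4) * X :=
        mul_le_mul' le_rfl (lintegral_mono_set (iUnion_subset fun k ↦ inter_subset_right))

end Local

/-! ### Superlevel sets of smooth functions -/

section Superlevel

variable {n : ℕ} {H : Type*} [TopologicalSpace H]
  (I : ModelWithCorners ℝ (EuclideanSpace ℝ (Fin n)) H)
  {M : Type*} [EMetricSpace M] [ChartedSpace H M] [IsManifold I ∞ M]

/-- Sard's theorem in the interior of a manifold. -/
theorem volume_image_interior_critical_eq_zero [SecondCountableTopology M] {f : M → ℝ}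
    (hf : ContMDiff I 𝓘(ℝ, ℝ) ∞ f) :
    volume (f '' {x | I.IsInteriorPoint x ∧ mfderiv I 𝓘(ℝ, ℝ) f x = 0}) = 0 := by
  refine volume_image_eq_zero_of_locally fun x hx ↦ ?_
  set φ := extChartAt I x
  let F : EuclideanSpace ℝ (Fin n) → ℝ := f ∘ φ.symm
  have hu : φ.source ∩ φ ⁻¹' interior (range I) ∈ 𝓝 x := by
    refine inter_mem (extChartAt_source_mem_nhds x) ?_
    exact continuousAt_extChartAt (I := I) x (isOpen_interior.mem_nhds hx.1)
  refine ⟨_, hu, measure_mono_null ?_ (volume_image_critical_eq_zero (f := F)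
    (S := {e | ContDiffAt ℝ ∞ F e ∧ fderiv ℝ F e = 0}) fun e he ↦ he)⟩
  rintro _ ⟨y, ⟨⟨hy, hyi⟩, -, hy0⟩, rfl⟩
  have hinv : φ.symm (φ y) = y := φ.left_inv hy
  have hrange : range I ∈ 𝓝 (φ y) := mem_interior_iff_mem_nhds.1 hyi
  have htarget : φ.target ∈ 𝓝 (φ y) := by
    have := extChartAt_target_mem_nhdsWithin' (I := I) hy
    rwa [nhdsWithin_eq_nhds.2 hrange] at this
  refine ⟨φ y, ⟨?_, ?_⟩, congrArg f hinv⟩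
  · have h1 : ContMDiffOn 𝓘(ℝ, EuclideanSpace ℝ (Fin n)) 𝓘(ℝ, ℝ) ∞ F φ.target :=
      hf.comp_contMDiffOn (contMDiffOn_extChartAt_symm x)
    exact (contMDiffOn_iff_contDiffOn.1 h1).contDiffAt htarget
  · have h1 : MDifferentiableAt 𝓘(ℝ, EuclideanSpace ℝ (Fin n)) I φ.symm (φ y) :=
      (mdifferentiableWithinAt_extChartAt_symm (I := I) (φ.map_source hy)).mdifferentiableAt
        hrange
    have h2 := ((hf.mdifferentiable (by simp)) (φ.symm (φ y))).hasMFDerivAt.comp (φ y)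
      h1.hasMFDerivAt
    have h3 : mfderiv I 𝓘(ℝ, ℝ) f (φ.symm (φ y)) = 0 := by rw [hinv]; exact hy0
    rw [h3] at h2
    rw [← mfderiv_eq_fderiv]
    exact h2.mfderiv.trans (ContinuousLinearMap.zero_comp _)

omit [IsManifold I ∞ M] in
/-- Critical points on `∂M` are harmless, as `IsSmoothDomain` puts no condition there. -/
lemma isSmoothDomain_superlevel {f : M → ℝ} (hf : ContMDiff I 𝓘(ℝ, ℝ) ∞ f) {t : ℝ}
    (ht : t ∉ f '' {x | I.IsInteriorPoint x ∧ mfderiv I 𝓘(ℝ, ℝ) f x = 0}) :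
    IsSmoothDomain I {x | t < f x} := by
  refine ⟨isOpen_lt continuous_const hf.continuous, fun x hx ↦ ⟨univ, isOpen_univ, mem_univ x,
    fun y ↦ f y - t, (hf.sub contMDiff_const).contMDiffOn, fun h0 ↦ ?_, ?_⟩⟩
  · have hfx : t = f x := frontier_lt_subset_eq continuous_const hf.continuous hx.1
    refine ht ⟨x, ⟨(I.isInteriorPoint_iff_not_isBoundaryPoint x).2 hx.2, ?_⟩, hfx.symm⟩
    have h := (((hf.mdifferentiable (by simp)) x).hasMFDerivAt.sub
      (hasMFDerivAt_const t x)).mfderiv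
    have h' : mfderiv I 𝓘(ℝ, ℝ) (fun y ↦ f y - t) x =
      (differential I f x - 0 : TangentSpace I x →L[ℝ] ℝ) := h
    rw [sub_zero] at h'
    exact h'.symm.trans h0
  · ext y; simp

end Superlevel

/-! ### Cauchy–Schwarz inequality and medians -/

section Measure

variable {X : Type*} [MeasurableSpace X] (ν : Measure X)

lemma lintegral_mul_sq_le {a b : X → ℝ≥0∞} (ha : AEMeasurable a ν) (hb : AEMeasurable b ν) :
    (∫⁻ x, a x * b x ∂ν) ^ 2 ≤ (∫⁻ x, a x ^ 2 ∂ν) * ∫⁻ x, b x ^ 2 ∂ν := by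
  have h := ENNReal.lintegral_mul_le_Lp_mul_Lq ν Real.HolderConjugate.two_two ha hb
  have h2 : ∀ z : ℝ≥0∞, (z ^ (1 / 2 : ℝ)) ^ 2 = z := fun z ↦ by
    rw [← ENNReal.rpow_natCast, ← ENNReal.rpow_mul]; norm_num
  calc (∫⁻ x, a x * b x ∂ν) ^ 2 ≤ _ := pow_le_pow_left' h 2
    _ = _ := by rw [mul_pow, h2, h2]; simp

lemma exists_median [IsFiniteMeasure ν] {f : X → ℝ} (hf : Measurable f) {C : ℝ}
    (hC : ∀ x, |f x| ≤ C) :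
    ∃ m, ν {x | m < f x} ≤ ν univ / 2 ∧ ν {x | f x < m} ≤ ν univ / 2 := by
  rcases eq_or_ne (ν univ) 0 with h0 | h0
  · refine ⟨0, ?_, ?_⟩ <;> exact (measure_mono (subset_univ _)).trans (by simp [h0])
  have hhalf : ν univ / 2 < ν univ := ENNReal.half_lt_self h0 (measure_ne_top ν _)
  let S : Set ℝ := {t | ν {x | t < f x} ≤ ν univ / 2}
  have hCS : C ∈ S := by
    have : {x | C < f x} = ∅ := by
      ext x; simpa using (le_abs_self _).trans (hC x)
    simp [S, this]
  have hbdd : BddBelow S := by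
    refine ⟨-C, fun t ht ↦ ?_⟩
    by_contra! hlt
    have : {x | t < f x} = univ := by
      ext x; simpa using hlt.trans_le (abs_le.1 (hC x)).1
    simp only [S, mem_ofPred_eq, this] at ht
    exact absurd ht (not_le.2 hhalf)
  have hmono : ∀ s ∈ S, ∀ t, s ≤ t → t ∈ S := fun s hs t hst ↦
    (measure_mono fun x hx ↦ hst.trans_lt hx).trans hs
  have hε : ∀ ε : ℝ, 0 < ε → ∃ k : ℕ, 1 / ((k : ℝ) + 1) < ε := fun ε hε ↦
    exists_nat_one_div_lt hε
  have hanti : ∀ {j k : ℕ}, j ≤ k → 1 / ((k : ℝ) + 1) ≤ 1 / ((j : ℝ) + 1) := fun h ↦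
    Nat.one_div_le_one_div h
  have hpos : ∀ k : ℕ, 0 < 1 / ((k : ℝ) + 1) := fun k ↦ Nat.one_div_pos_of_nat
  refine ⟨sInf S, ?_, ?_⟩
  · have hU : {x | sInf S < f x} = ⋃ k : ℕ, {x | sInf S + 1 / ((k : ℝ) + 1) < f x} := by
      ext x
      simp only [mem_ofPred_eq, mem_iUnion]
      refine ⟨fun h ↦ ?_, fun ⟨k, hk⟩ ↦ by linarith [hpos k]⟩
      obtain ⟨k, hk⟩ := hε _ (sub_pos.2 h)
      exact ⟨k, by linarith⟩
    have hm : Monotone fun k : ℕ ↦ {x | sInf S + 1 / ((k : ℝ) + 1) < f x} := fun j k hjk x hx ↦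
      (add_le_add_right (hanti hjk) _).trans_lt hx
    rw [hU, hm.measure_iUnion]
    refine iSup_le fun k ↦ ?_
    obtain ⟨s, hs, hs'⟩ := exists_lt_of_csInf_lt ⟨C, hCS⟩ (lt_add_of_pos_right (sInf S) (hpos k))
    exact hmono s hs _ hs'.le
  · have hU : {x | f x < sInf S} = ⋃ k : ℕ, {x | f x ≤ sInf S - 1 / ((k : ℝ) + 1)} := by
      ext x
      simp only [mem_ofPred_eq, mem_iUnion]
      refine ⟨fun h ↦ ?_, fun ⟨k, hk⟩ ↦ by linarith [hpos k]⟩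
      obtain ⟨k, hk⟩ := hε _ (sub_pos.2 h)
      exact ⟨k, by linarith⟩
    have hm : Monotone fun k : ℕ ↦ {x | f x ≤ sInf S - 1 / ((k : ℝ) + 1)} := fun j k hjk x hx ↦
      le_trans hx (sub_le_sub_left (hanti hjk) _)
    rw [hU, hm.measure_iUnion]
    refine iSup_le fun k ↦ ?_
    set s := sInf S - 1 / ((k : ℝ) + 1)
    have hs : s ∉ S := fun h ↦ by
      have := csInf_le hbdd h
      have := hpos k
      linarith
    have hs' : ν univ / 2 ≤ ν {x | s < f x} := (not_le.1 hs).le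
    have hcompl : {x | f x ≤ s} = {x | s < f x}ᶜ := by ext x; simp
    rw [hcompl, measure_compl (measurableSet_lt measurable_const hf) (measure_ne_top ν _)]
    refine (tsub_le_tsub_left hs' _).trans ?_
    rw [ENNReal.sub_half (measure_ne_top ν _)]

end Measure

/-! ### Cheeger's inequality for smooth functions -/

section Smooth

variable {n : ℕ} {H : Type*} [TopologicalSpace H]
  (I : ModelWithCorners ℝ (EuclideanSpace ℝ (Fin n)) H)
  {M : Type*} [EMetricSpace M] [CompactSpace M] [MeasurableSpace M] [BorelSpace M]
  [ChartedSpace H M] [IsManifold I ∞ M]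
  [RiemannianBundle (fun x : M ↦ TangentSpace I x)]
  [IsContinuousRiemannianBundle (EuclideanSpace ℝ (Fin n)) (fun x : M ↦ TangentSpace I x)]
  [IsRiemannianManifold I M]

/-- The isoperimetric inequality for superlevel sets, integrated over the levels: the left side by
the layer cake formula, the right side by the coarea inequality for the weight `f σ`. -/
lemma cheegerConstant_mul_lintegral_le {m : ℕ} (hn : n = m + 1) {f ρ σ : M → ℝ}
    (hf : ContMDiff I 𝓘(ℝ, ℝ) ∞ f) (hρ : Continuous ρ) (hσ : Continuous σ)
    (hσ_pos : ∀ x, 0 < σ x)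
    (h0 : weightedVolume n σ {x | 0 < f x} ≤ weightedVolume n σ univ / 2) :
    cheegerConstant I ρ σ *
        ∫⁻ x, ENNReal.ofReal (ρ x) * ENNReal.ofReal (max (f x) 0) ^ 2 ∂(μHE[n] : Measure M) ≤
      2 * ∫⁻ x in {x | 0 < f x}, ENNReal.ofReal (f x * σ x) * ‖riemannianGradient I f x‖ₑ
        ∂(μHE[n] : Measure M) := by
  have : SecondCountableTopology M := EMetric.secondCountable_of_sigmaCompact M
  set μ : Measure M := μHE[n] with hμ
  set ν : Measure M := μ.withDensity fun x ↦ ENNReal.ofReal (ρ x) with hν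
  have hfm : Measurable f := hf.continuous.measurable
  have hρm : Measurable fun x ↦ ENNReal.ofReal (ρ x) := hρ.measurable.ennreal_ofReal
  have hgm : Measurable fun x ↦ max (f x) 0 := hfm.max measurable_const
  have hνD : ∀ t : ℝ, ν {x | t < f x} = weightedVolume n ρ {x | t < f x} := fun t ↦
    withDensity_apply _ (measurableSet_lt measurable_const hfm)
  have hlayer : ∫⁻ x, ENNReal.ofReal (ρ x) * ENNReal.ofReal (max (f x) 0) ^ 2 ∂μ =
      2 * ∫⁻ t in Ioi (0 : ℝ), weightedVolume n ρ {x | t < f x} * ENNReal.ofReal t := by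
    have h1 := lintegral_rpow_eq_lintegral_meas_lt_mul ν (f := fun x ↦ max (f x) 0)
      (Eventually.of_forall fun x ↦ le_max_right _ _) hgm.aemeasurable (p := 2) two_pos
    rw [lintegral_withDensity_eq_lintegral_mul _ hρm (by fun_prop)] at h1
    convert h1 using 1
    · refine lintegral_congr fun x ↦ ?_
      rw [Pi.mul_apply, ← ENNReal.ofReal_pow (le_max_right _ _), ← Real.rpow_natCast]
      norm_num
    · congr 1
      · norm_num
      · refine setLIntegral_congr_fun measurableSet_Ioi fun t (ht : 0 < t) ↦ ?_
        have : {x | t < max (f x) 0} = {x | t < f x} := by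
          ext x; simp [ht.le]
        simp only [this, hνD]
        norm_num
  -- At a regular level `t > 0` the relative boundary of `{t < f}` lies in `A ∩ {f = t}`.
  set A : Set M := {x | I.IsInteriorPoint x ∧ riemannianGradient I f x ≠ 0 ∧ 0 < f x}
  have hcoarea := lintegral_levelSet_le I hn (hf.of_le (by simp))
    (hf.continuous.mul hσ) (A := A) (B := {x | 0 < f x}) (fun x hx ↦ hx.2.2)
    (measurableSet_lt measurable_const hfm)
    (fun x hx ↦ ⟨hx.1, hx.2.1, mul_pos hx.2.2 (hσ_pos x)⟩)
  rw [hlayer, mul_left_comm]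
  refine mul_le_mul' le_rfl (le_trans ?_ hcoarea)
  refine (lintegral_const_mul_le _ _).trans (le_trans ?_ (setLIntegral_le_lintegral (Ioi 0) _))
  -- By Sard's theorem almost every superlevel set is a smooth domain.
  have hsard : ∀ᵐ t : ℝ, t ∉ f '' {x | I.IsInteriorPoint x ∧ mfderiv I 𝓘(ℝ, ℝ) f x = 0} :=
    measure_eq_zero_iff_ae_notMem.1 (volume_image_interior_critical_eq_zero I hf)
  refine lintegral_mono_ae ?_
  filter_upwards [ae_restrict_of_ae hsard, ae_restrict_mem measurableSet_Ioi] with t ht ht0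
  have ht0' : 0 < t := ht0
  rcases {x | t < f x}.eq_empty_or_nonempty with he | hne
  · simp [he, weightedVolume]
  have hle : weightedVolume n σ {x | t < f x} ≤ weightedVolume n σ univ / 2 :=
    le_trans (lintegral_mono_set fun x hx ↦ ht0'.trans hx) h0
  have hch : cheegerConstant I ρ σ * weightedVolume n ρ {x | t < f x} ≤
      weightedVolume (n - 1) σ (frontier {x | t < f x} \ I.boundary M) := by
    refine ENNReal.mul_le_of_le_div ?_
    exact iInf_le_of_le _ (iInf_le_of_le (isSmoothDomain_superlevel I hf ht)
      (iInf_le_of_le hne (iInf_le _ hle)))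
  have hnm : n - 1 = m := by lia
  rw [hnm] at hch
  have hsub : frontier {x | t < f x} \ I.boundary M ⊆ A ∩ {x | f x = t} := by
    intro x hx
    have hfx : t = f x := frontier_lt_subset_eq continuous_const hf.continuous hx.1
    have hxi := (I.isInteriorPoint_iff_not_isBoundaryPoint x).2 hx.2
    exact ⟨⟨hxi, fun h ↦ ht ⟨x, ⟨hxi, (riemannianGradient_eq_zero_iff I).1 h⟩, hfx.symm⟩,
      hfx ▸ ht0'⟩, hfx.symm⟩
  rw [← mul_assoc]
  refine (mul_le_mul' hch le_rfl).trans ?_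
  rw [weightedVolume, ← lintegral_mul_const' _ _ ENNReal.ofReal_ne_top]
  refine (lintegral_mono_set hsub).trans (lintegral_mono_ae ?_)
  have hlev : MeasurableSet {x | f x = t} := hfm (measurableSet_singleton t)
  filter_upwards [ae_restrict_of_ae_restrict_of_subset inter_subset_right (ae_restrict_mem hlev)]
    with x hx
  have hx' : f x = t := hx
  rw [Pi.mul_apply, hx', ENNReal.ofReal_mul ht0'.le, mul_comm]

/-- Cheeger's argument for a function whose positivity set is at most half of the manifold. -/
lemma cheegerConstant_mul_lintegral_posPart_le {m : ℕ} (hn : n = m + 1) {f ρ σ : M → ℝ}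
    (hf : ContMDiff I 𝓘(ℝ, ℝ) ∞ f) (hρ : Continuous ρ) (hσ : Continuous σ)
    (hσ_pos : ∀ x, 0 < σ x)
    (h0 : weightedVolume n σ {x | 0 < f x} ≤ weightedVolume n σ univ / 2) :
    1 / 4 * cheegerConstant I σ σ * cheegerConstant I ρ σ *
        ∫⁻ x, ENNReal.ofReal (ρ x) * ENNReal.ofReal (max (f x) 0) ^ 2 ∂(μHE[n] : Measure M) ≤
      ∫⁻ x in {x | 0 < f x}, ‖riemannianGradient I f x‖ₑ ^ 2 * ENNReal.ofReal (σ x)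
        ∂(μHE[n] : Measure M) := by
  have hfin : IsFiniteMeasure (μHE[n] : Measure M) := isFiniteMeasure_riemannianVolume I
  set μ : Measure M := μHE[n] with hμ
  have hρ' := cheegerConstant_mul_lintegral_le I hn hf hρ hσ hσ_pos h0
  have hσ' := cheegerConstant_mul_lintegral_le I hn hf hσ hσ hσ_pos h0
  rw [← hμ] at hρ' hσ'
  set R := ∫⁻ x, ENNReal.ofReal (ρ x) * ENNReal.ofReal (max (f x) 0) ^ 2 ∂μ
  set P := ∫⁻ x, ENNReal.ofReal (σ x) * ENNReal.ofReal (max (f x) 0) ^ 2 ∂μ with hP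
  set J := ∫⁻ x in {x | 0 < f x}, ENNReal.ofReal (f x * σ x) * ‖riemannianGradient I f x‖ₑ ∂μ
    with hJ
  set Q := ∫⁻ x in {x | 0 < f x}, ‖riemannianGradient I f x‖ₑ ^ 2 * ENNReal.ofReal (σ x) ∂μ
    with hQ
  have hfm : Measurable f := hf.continuous.measurable
  have hσm : Measurable fun x ↦ ENNReal.ofReal (σ x) := hσ.measurable.ennreal_ofReal
  have hgrad : Measurable fun x ↦ ‖riemannianGradient I f x‖ₑ := by
    have h1 : Measurable fun x ↦ ‖riemannianGradient I f x‖ :=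
      (lowerSemicontinuous_norm_riemannianGradient I (hf.of_le (by simp))).measurable
    simpa only [ofReal_norm] using h1.ennreal_ofReal
  have hset : MeasurableSet {x | 0 < f x} := measurableSet_lt measurable_const hfm
  have hCS : J ^ 2 ≤ P * Q := by
    have h1 := lintegral_mul_sq_le
      ((μ.restrict {x | 0 < f x}).withDensity fun x ↦ ENNReal.ofReal (σ x))
      (a := fun x ↦ ENNReal.ofReal (f x)) (b := fun x ↦ ‖riemannianGradient I f x‖ₑ)
      hfm.ennreal_ofReal.aemeasurable hgrad.aemeasurable
    rw [lintegral_withDensity_eq_lintegral_mul _ hσm (by fun_prop),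
      lintegral_withDensity_eq_lintegral_mul _ hσm (by fun_prop),
      lintegral_withDensity_eq_lintegral_mul _ hσm (by fun_prop)] at h1
    have e1 : J = ∫⁻ x in {x | 0 < f x}, ((fun x ↦ ENNReal.ofReal (σ x)) *
        fun x ↦ ENNReal.ofReal (f x) * ‖riemannianGradient I f x‖ₑ) x ∂μ := by
      refine setLIntegral_congr_fun hset fun x (hx : 0 < f x) ↦ ?_
      simp only [Pi.mul_apply]
      rw [ENNReal.ofReal_mul hx.le]
      ring
    have e2 : ∫⁻ x in {x | 0 < f x}, ((fun x ↦ ENNReal.ofReal (σ x)) *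
        fun x ↦ ENNReal.ofReal (f x) ^ 2) x ∂μ ≤ P := by
      refine le_trans (setLIntegral_mono' hset fun x (hx : 0 < f x) ↦ ?_)
        (setLIntegral_le_lintegral _ _)
      simp [max_eq_left hx.le]
    have e3 : ∫⁻ x in {x | 0 < f x}, ((fun x ↦ ENNReal.ofReal (σ x)) *
        fun x ↦ ‖riemannianGradient I f x‖ₑ ^ 2) x ∂μ = Q := by
      refine lintegral_congr fun x ↦ ?_
      simp only [Pi.mul_apply, mul_comm]
    rw [e1]
    exact h1.trans (mul_le_mul' e2 e3.le)
  have hPtop : P ≠ ⊤ := by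
    obtain ⟨C, hC⟩ := (isCompact_univ (X := M)).bddAbove_image
      (f := fun x ↦ σ x * max (f x) 0 ^ 2)
      (hσ.mul ((hf.continuous.max continuous_const).pow 2)).continuousOn
    refine ne_top_of_le_ne_top (ENNReal.mul_ne_top (ENNReal.ofReal_ne_top (r := C))
      (measure_ne_top μ univ)) ?_
    rw [← lintegral_const]
    refine lintegral_mono fun x ↦ ?_
    rw [← ENNReal.ofReal_pow (le_max_right _ _), ← ENNReal.ofReal_mul (hσ_pos x).le]
    exact ENNReal.ofReal_le_ofReal (hC (mem_image_of_mem _ (mem_univ x)))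
  -- If `P = 0`, then `J = 0`; otherwise `P` may be cancelled.
  rcases eq_or_ne P 0 with hP0 | hP0
  · have hJ0 : J = 0 := by
      rw [hP0, zero_mul] at hCS
      exact pow_eq_zero_iff two_ne_zero |>.1 (le_antisymm hCS zero_le)
    rw [hJ0, mul_zero] at hρ'
    have : cheegerConstant I ρ σ * R = 0 := le_antisymm hρ' zero_le
    rw [mul_assoc, this, mul_zero]
    exact zero_le
  · rw [← ENNReal.mul_le_mul_iff_right hP0 hPtop]
    calc P * (1 / 4 * cheegerConstant I σ σ * cheegerConstant I ρ σ * R)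
        = 1 / 4 * ((cheegerConstant I σ σ * P) * (cheegerConstant I ρ σ * R)) := by ring
      _ ≤ 1 / 4 * ((2 * J) * (2 * J)) := by gcongr
      _ = (1 / 4 * 4) * J ^ 2 := by ring
      _ = J ^ 2 := by
          rw [ENNReal.div_mul_cancel (by norm_num) (by norm_num), one_mul]
      _ ≤ P * Q := hCS

/-- Cheeger's inequality for a smooth function, shifted by a median. -/
theorem exists_cheegerConstant_mul_lintegral_sub_le {m : ℕ} (hn : n = m + 1) {f ρ σ : M → ℝ}
    (hf : ContMDiff I 𝓘(ℝ, ℝ) ∞ f) (hρ : Continuous ρ) (hσ : Continuous σ)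
    (hσ_pos : ∀ x, 0 < σ x) :
    ∃ c : ℝ, 1 / 4 * cheegerConstant I σ σ * cheegerConstant I ρ σ *
        ∫⁻ x, ENNReal.ofReal (ρ x) * ‖f x - c‖ₑ ^ 2 ∂(μHE[n] : Measure M) ≤
      ∫⁻ x, ‖riemannianGradient I f x‖ₑ ^ 2 * ENNReal.ofReal (σ x) ∂(μHE[n] : Measure M) := by
  have hfin : IsFiniteMeasure (μHE[n] : Measure M) := isFiniteMeasure_riemannianVolume I
  set μ : Measure M := μHE[n] with hμ
  have hfm : Measurable f := hf.continuous.measurable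
  have hρm : Measurable fun x ↦ ENNReal.ofReal (ρ x) := hρ.measurable.ennreal_ofReal
  let ν : Measure M := μ.withDensity fun x ↦ ENNReal.ofReal (σ x)
  have hν : ∀ s, MeasurableSet s → ν s = weightedVolume n σ s := fun s hs ↦
    withDensity_apply _ hs
  have hνfin : IsFiniteMeasure ν := by
    obtain ⟨C, hC⟩ := (isCompact_univ (X := M)).bddAbove_image hσ.continuousOn
    refine isFiniteMeasure_withDensity ?_
    refine ne_top_of_le_ne_top (ENNReal.mul_ne_top (ENNReal.ofReal_ne_top (r := C))
      (measure_ne_top μ univ)) ?_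
    rw [← lintegral_const]
    exact lintegral_mono fun x ↦
      ENNReal.ofReal_le_ofReal (hC (mem_image_of_mem _ (mem_univ x)))
  obtain ⟨C, hC⟩ := (isCompact_univ (X := M)).bddAbove_image hf.continuous.abs.continuousOn
  obtain ⟨c, hc1, hc2⟩ := exists_median ν hfm fun x ↦ hC (mem_image_of_mem _ (mem_univ x))
  rw [hν _ (measurableSet_lt measurable_const hfm), hν _ MeasurableSet.univ] at hc1
  rw [hν _ (measurableSet_lt hfm measurable_const), hν _ MeasurableSet.univ] at hc2
  have hfc : ContMDiff I 𝓘(ℝ, ℝ) ∞ fun x ↦ f x - c := hf.sub contMDiff_const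
  have hfc' : ContMDiff I 𝓘(ℝ, ℝ) ∞ fun x ↦ -(f x - c) := hfc.neg
  have hg1 : ∀ x, riemannianGradient I (fun x ↦ f x - c) x = riemannianGradient I f x :=
    fun x ↦ riemannianGradient_sub_const I (hf.mdifferentiable (by simp) x) c
  have hg2 : ∀ x, ‖riemannianGradient I (fun x ↦ -(f x - c)) x‖ₑ =
      ‖riemannianGradient I f x‖ₑ := fun x ↦ by
    rw [riemannianGradient_neg I (fun x ↦ f x - c) x, hg1, enorm_neg]
  have s1 : {x | 0 < f x - c} = {x | c < f x} := by ext x; simp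
  have s2 : {x | 0 < -(f x - c)} = {x | f x < c} := by ext x; simp
  have h1 := cheegerConstant_mul_lintegral_posPart_le I hn hfc hρ hσ hσ_pos (by rwa [s1])
  have h2 := cheegerConstant_mul_lintegral_posPart_le I hn hfc' hρ hσ hσ_pos (by rwa [s2])
  simp only [hg1, s1] at h1
  simp only [hg2, s2] at h2
  refine ⟨c, ?_⟩
  have hsplit : ∫⁻ x, ENNReal.ofReal (ρ x) * ‖f x - c‖ₑ ^ 2 ∂μ =
      ∫⁻ x, ENNReal.ofReal (ρ x) * ENNReal.ofReal (max (f x - c) 0) ^ 2 ∂μ +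
      ∫⁻ x, ENNReal.ofReal (ρ x) * ENNReal.ofReal (max (-(f x - c)) 0) ^ 2 ∂μ := by
    rw [← lintegral_add_left (by fun_prop)]
    refine lintegral_congr fun x ↦ ?_
    rw [← mul_add, ← ofReal_norm, Real.norm_eq_abs]
    congr 1
    rcases le_total 0 (f x - c) with h | h
    · rw [abs_of_nonneg h, max_eq_left h, max_eq_right (by linarith)]; simp
    · rw [abs_of_nonpos h, max_eq_right h, max_eq_left (by linarith)]; simp
  rw [hsplit, mul_add]
  refine (add_le_add h1 h2).trans ?_
  have hdisj : Disjoint {x | c < f x} {x | f x < c} :=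
    disjoint_left.2 fun x hx hx' ↦ lt_asymm (show c < f x from hx) hx'
  rw [← lintegral_union (measurableSet_lt hfm measurable_const) hdisj]
  exact setLIntegral_le_lintegral _ _

end Smooth

/-! ### Passage to the Sobolev space -/

lemma enorm_add_sq_le {V : Type*} [SeminormedAddCommGroup V] (a b : V) {δ : NNReal} (hδ : 0 < δ) :
    ‖a + b‖ₑ ^ 2 ≤ (1 + δ : NNReal) * ‖a‖ₑ ^ 2 + (1 + δ⁻¹ : NNReal) * ‖b‖ₑ ^ 2 := by
  have hδ' : (0 : ℝ) < δ := hδ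
  have h : ‖a + b‖ ^ 2 ≤ (1 + δ) * ‖a‖ ^ 2 + (1 + (δ : ℝ)⁻¹) * ‖b‖ ^ 2 := by
    have h1 : ‖a + b‖ ^ 2 ≤ (‖a‖ + ‖b‖) ^ 2 := by gcongr; exact norm_add_le a b
    have h2 : 0 ≤ (δ : ℝ)⁻¹ * (δ * ‖a‖ - ‖b‖) ^ 2 := by positivity
    have h3 : (δ : ℝ)⁻¹ * (δ * ‖a‖ - ‖b‖) ^ 2 =
        δ * ‖a‖ ^ 2 - 2 * ‖a‖ * ‖b‖ + (δ : ℝ)⁻¹ * ‖b‖ ^ 2 := by field_simp; ring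
    nlinarith
  have h' : ‖a + b‖₊ ^ 2 ≤ (1 + δ) * ‖a‖₊ ^ 2 + (1 + δ⁻¹) * ‖b‖₊ ^ 2 := by
    rw [← NNReal.coe_le_coe]; push_cast; exact h
  simp only [enorm]
  exact_mod_cast h'

/-- `s` is not assumed measurable: it will be `|∇f - V|²`. -/
lemma lintegral_mul_le_add {X : Type*} [MeasurableSpace X] {μ : Measure X}
    {p q s w : X → ℝ≥0∞} {α β C : NNReal} (hq : Measurable q) (hw : Measurable w)
    (hwC : ∀ x, w x ≤ C) (h : ∀ x, p x ≤ α * q x + β * s x) :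
    ∫⁻ x, p x * w x ∂μ ≤ α * ∫⁻ x, q x * w x ∂μ + (β * C : NNReal) * ∫⁻ x, s x ∂μ := by
  have hqw : Measurable fun x ↦ q x * w x := hq.mul hw
  rw [← lintegral_const_mul _ hqw, ← lintegral_const_mul' _ _ ENNReal.coe_ne_top,
    ← lintegral_add_left (hqw.const_mul _)]
  refine lintegral_mono fun x ↦ ?_
  calc p x * w x ≤ (α * q x + β * s x) * w x := by gcongr; exact h x
    _ = α * (q x * w x) + β * w x * s x := by ring
    _ ≤ α * (q x * w x) + β * C * s x := by gcongr; exact hwC x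
    _ = _ := by push_cast; rfl

/-- A function of mean zero is, among its translates by constants, the smallest in `L²`. -/
lemma lintegral_sq_le_lintegral_sub_sq {X : Type*} [MeasurableSpace X] {μ : Measure X}
    [IsFiniteMeasure μ] {u ρ : X → ℝ} (hu : MemLp u 2 μ) (hρ : AEStronglyMeasurable ρ μ)
    (hρ_nonneg : ∀ x, 0 ≤ ρ x) {C : ℝ} (hC : ∀ x, ρ x ≤ C) (h0 : ∫ x, ρ x * u x ∂μ = 0) (c : ℝ) :
    ∫⁻ x, ‖u x‖ₑ ^ 2 * ENNReal.ofReal (ρ x) ∂μ ≤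
      ∫⁻ x, ‖u x - c‖ₑ ^ 2 * ENNReal.ofReal (ρ x) ∂μ := by
  have hbd : ∀ᵐ x ∂μ, ‖ρ x‖ ≤ C :=
    Eventually.of_forall fun x ↦ by rw [Real.norm_of_nonneg (hρ_nonneg x)]; exact hC x
  have i0 : Integrable (fun x ↦ ρ x * (u x ^ 2)) μ := hu.integrable_sq.bdd_mul hρ hbd
  have i1 : Integrable (fun x ↦ ρ x * u x) μ :=
    (hu.integrable one_le_two).bdd_mul hρ hbd
  have i2 : Integrable (fun x ↦ ρ x * 1) μ := (integrable_const (1 : ℝ)).bdd_mul hρ hbd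
  have e : ∀ x, ρ x * (u x - c) ^ 2 =
      ρ x * u x ^ 2 - 2 * c * (ρ x * u x) + c ^ 2 * (ρ x * 1) := fun x ↦ by ring
  have i3 : Integrable (fun x ↦ ρ x * (u x - c) ^ 2) μ := by
    simp only [e]
    exact (i0.sub (i1.const_mul _)).add (i2.const_mul _)
  have conv : ∀ v : X → ℝ, Integrable (fun x ↦ ρ x * v x ^ 2) μ →
      ∫⁻ x, ‖v x‖ₑ ^ 2 * ENNReal.ofReal (ρ x) ∂μ = ENNReal.ofReal (∫ x, ρ x * v x ^ 2 ∂μ) := by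
    intro v hv
    rw [ofReal_integral_eq_lintegral_ofReal hv
      (Eventually.of_forall fun x ↦ mul_nonneg (hρ_nonneg x) (sq_nonneg _))]
    refine lintegral_congr fun x ↦ ?_
    rw [← ofReal_norm, ← ENNReal.ofReal_pow (norm_nonneg _), Real.norm_eq_abs, sq_abs,
      ENNReal.ofReal_mul (hρ_nonneg x), mul_comm]
  rw [conv u i0, conv (fun x ↦ u x - c) i3]
  refine ENNReal.ofReal_le_ofReal ?_
  simp only [e]
  have i4 : Integrable (fun x ↦ ρ x * u x ^ 2 - 2 * c * (ρ x * u x)) μ := i0.sub (i1.const_mul _)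
  rw [integral_add i4 (i2.const_mul _), integral_sub i0 (i1.const_mul _),
    integral_const_mul, integral_const_mul, h0]
  have : 0 ≤ ∫ x, ρ x * 1 ∂μ := integral_nonneg fun x ↦ by simpa using hρ_nonneg x
  nlinarith [sq_nonneg c, mul_nonneg (sq_nonneg c) this]

/-- A two-dimensional space of functions contains a nonzero function of weighted mean zero. -/
lemma exists_mem_ne_zero_integral_eq_zero {X : Type*} [MeasurableSpace X] {μ : Measure X}
    [IsFiniteMeasure μ] {ρ : X → ℝ} (hρ : AEStronglyMeasurable ρ μ) {C : ℝ}
    (hC : ∀ x, ‖ρ x‖ ≤ C) (E : Submodule ℝ (Lp ℝ 2 μ)) (hE : Module.finrank ℝ E = 2) :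
    ∃ u ∈ E, u ≠ 0 ∧ ∫ x, ρ x * u x ∂μ = 0 := by
  have hi : ∀ u : Lp ℝ 2 μ, Integrable (fun x ↦ ρ x * u x) μ := fun u ↦
    ((Lp.memLp u).integrable one_le_two).bdd_mul hρ (Eventually.of_forall hC)
  let L : E →ₗ[ℝ] ℝ :=
    { toFun := fun u ↦ ∫ x, ρ x * (u : Lp ℝ 2 μ) x ∂μ
      map_add' := fun u v ↦ by
        rw [← integral_add (hi u) (hi v)]
        refine integral_congr_ae ?_
        filter_upwards [Lp.coeFn_add (u : Lp ℝ 2 μ) v] with x hx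
        rw [Submodule.coe_add, hx, Pi.add_apply, mul_add]
      map_smul' := fun a u ↦ by
        rw [RingHom.id_apply, smul_eq_mul, ← integral_const_mul]
        refine integral_congr_ae ?_
        filter_upwards [Lp.coeFn_smul a (u : Lp ℝ 2 μ)] with x hx
        rw [Submodule.coe_smul, hx, Pi.smul_apply, smul_eq_mul, mul_left_comm] }
  have : Module.Finite ℝ E := Module.finite_of_finrank_pos (by lia)
  obtain ⟨u, hu, hu0⟩ := Submodule.exists_mem_ne_zero_of_ne_bot
    (LinearMap.ker_ne_bot_of_finrank_lt (f := L) (by rw [hE]; simp))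
  exact ⟨u, u.2, by simpa using hu0, hu⟩

section Sobolev

variable {n : ℕ} {H : Type*} [TopologicalSpace H]
  (I : ModelWithCorners ℝ (EuclideanSpace ℝ (Fin n)) H)
  {M : Type*} [EMetricSpace M] [CompactSpace M] [MeasurableSpace M] [BorelSpace M]
  [ChartedSpace H M] [IsManifold I ∞ M]
  [RiemannianBundle (fun x : M ↦ TangentSpace I x)]
  [IsContinuousRiemannianBundle (EuclideanSpace ℝ (Fin n)) (fun x : M ↦ TangentSpace I x)]

omit [CompactSpace M] [BorelSpace M] in
lemma measurable_enorm_vectorField {V : (x : M) → TangentSpace I x}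
    (hV : Measurable[_, borel (TangentBundle I M)]
      (fun x ↦ (⟨x, V x⟩ : TangentBundle I M))) :
    Measurable fun x ↦ ‖V x‖ₑ := by
  let _ : MeasurableSpace (TangentBundle I M) := borel _
  have : BorelSpace (TangentBundle I M) := ⟨rfl⟩
  have h1 : Continuous fun p : TangentBundle I M ↦ (inner ℝ p.2 p.2 : ℝ) :=
    Continuous.inner_bundle (F := EuclideanSpace ℝ (Fin n)) (b := fun p : TangentBundle I M ↦ p.1)
      (v := fun p ↦ p.2) (w := fun p ↦ p.2) continuous_id continuous_id
  have h2 : Measurable fun x ↦ ‖V x‖ := by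
    have h3 : (fun x ↦ ‖V x‖) = fun x ↦ √(inner ℝ (V x) (V x)) :=
      funext fun x ↦ norm_eq_sqrt_real_inner _
    rw [h3]
    exact (Real.continuous_sqrt.comp h1).measurable.comp hV
  simpa only [ofReal_norm] using h2.ennreal_ofReal

variable [IsRiemannianManifold I M]

/-- Cheeger's inequality for a function of mean zero in `H¹(M)` and any of its Sobolev gradients. -/
theorem cheegerConstant_mul_lintegral_le_of_isSobolevGradient {m : ℕ} (hn : n = m + 1)
    {ρ σ : M → ℝ} (hρ : Continuous ρ) (hσ : Continuous σ)
    (hρ_pos : ∀ x, 0 < ρ x) (hσ_pos : ∀ x, 0 < σ x) {u : Lp ℝ 2 (μHE[n] : Measure M)}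
    {V : (x : M) → TangentSpace I x} (huV : IsSobolevGradient I u V)
    (h0 : ∫ x, ρ x * u x ∂(μHE[n] : Measure M) = 0) :
    1 / 4 * cheegerConstant I σ σ * cheegerConstant I ρ σ *
        ∫⁻ x, ‖u x‖ₑ ^ 2 * ENNReal.ofReal (ρ x) ∂(μHE[n] : Measure M) ≤
      ∫⁻ x, ‖V x‖ₑ ^ 2 * ENNReal.ofReal (σ x) ∂(μHE[n] : Measure M) := by
  have hfin : IsFiniteMeasure (μHE[n] : Measure M) := isFiniteMeasure_riemannianVolume I
  set κ := 1 / 4 * cheegerConstant I σ σ * cheegerConstant I ρ σ with hκ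
  set U := ∫⁻ x, ‖u x‖ₑ ^ 2 * ENNReal.ofReal (ρ x) ∂(μHE[n] : Measure M) with hU
  set W := ∫⁻ x, ‖V x‖ₑ ^ 2 * ENNReal.ofReal (σ x) ∂(μHE[n] : Measure M) with hW
  have hbound : ∀ w : M → ℝ, Continuous w → ∃ C : NNReal, ∀ x, w x ≤ C := fun w hw ↦ by
    obtain ⟨C, hC⟩ := (isCompact_univ (X := M)).bddAbove_image hw.continuousOn
    exact ⟨C.toNNReal, fun x ↦
      (hC (mem_image_of_mem _ (mem_univ x))).trans (Real.le_coe_toNNReal C)⟩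
  obtain ⟨Cρ, hCρ⟩ := hbound ρ hρ
  obtain ⟨Cσ, hCσ⟩ := hbound σ hσ
  have hCρ' : ∀ x, ENNReal.ofReal (ρ x) ≤ Cρ := fun x ↦
    (ENNReal.ofReal_le_ofReal (hCρ x)).trans_eq ENNReal.ofReal_coe_nnreal
  have hCσ' : ∀ x, ENNReal.ofReal (σ x) ≤ Cσ := fun x ↦
    (ENNReal.ofReal_le_ofReal (hCσ x)).trans_eq ENNReal.ofReal_coe_nnreal
  obtain ⟨hVm, f, hf, hfu, hfV⟩ := huV
  have hVm' := measurable_enorm_vectorField I hVm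
  -- The constants may be infinite; it suffices to treat all finite `k ≤ κ`.
  suffices h : ∀ k : NNReal, (k : ℝ≥0∞) ≤ κ → ∀ δ : NNReal, 0 < δ →
      k * U ≤ ((1 + δ) * (1 + δ) : NNReal) * W by
    have h1 : ∀ k : NNReal, (k : ℝ≥0∞) ≤ κ → k * U ≤ W := by
      intro k hk
      have hlim : Tendsto (fun δ : NNReal ↦ (((1 + δ) * (1 + δ) : NNReal) : ℝ≥0∞) * W)
          (𝓝[>] 0) (𝓝 W) := by
        have h2 : Tendsto (fun δ : NNReal ↦ (((1 + δ) * (1 + δ) : NNReal) : ℝ≥0∞)) (𝓝 0)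
            (𝓝 (((1 + 0) * (1 + 0) : NNReal) : ℝ≥0∞)) :=
          (ENNReal.continuous_coe.comp (by fun_prop :
            Continuous fun δ : NNReal ↦ (1 + δ) * (1 + δ))).tendsto 0
        have h3 := h2.mono_left (nhdsWithin_le_nhds (s := Ioi 0))
        simp only [add_zero, mul_one, ENNReal.coe_one] at h3
        simpa using ENNReal.Tendsto.mul_const (b := W) h3 (Or.inl one_ne_zero)
      exact ge_of_tendsto hlim (by filter_upwards [self_mem_nhdsWithin] with δ hδ using h k hk δ hδ)
    refine ENNReal.mul_le_of_forall_lt fun a ha b hb ↦ ?_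
    lift a to NNReal using ha.ne_top
    exact (mul_le_mul' le_rfl hb.le).trans (h1 a ha.le)
  intro k hk δ hδ
  -- Compare `u` with `f j` and `∇(f j)` with `V` by `(a + b)² ≤ (1 + δ) a² + γ b²`.
  set γ : NNReal := 1 + δ⁻¹ with hγ
  have hj : ∀ j, (k : ℝ≥0∞) * U ≤ ((1 + δ) * (1 + δ) : NNReal) * W +
      (((1 + δ) * (γ * Cσ) : NNReal) *
          ∫⁻ x, ‖riemannianGradient I (f j) x - V x‖ₑ ^ 2 ∂(μHE[n] : Measure M) +
        (k * (γ * Cρ) : NNReal) * ∫⁻ x, ‖f j x - u x‖ₑ ^ 2 ∂(μHE[n] : Measure M)) := by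
    intro j
    have hfm : Measurable (f j) := (hf j).continuous.measurable
    obtain ⟨c, hc⟩ := exists_cheegerConstant_mul_lintegral_sub_le I hn (hf j) hρ hσ hσ_pos
    rw [← hκ] at hc
    have a1 : U ≤ ∫⁻ x, ‖u x - c‖ₑ ^ 2 * ENNReal.ofReal (ρ x) ∂(μHE[n] : Measure M) :=
      lintegral_sq_le_lintegral_sub_sq (Lp.memLp u) hρ.aestronglyMeasurable
        (fun x ↦ (hρ_pos x).le) hCρ h0 c
    have a2 : ∫⁻ x, ‖u x - c‖ₑ ^ 2 * ENNReal.ofReal (ρ x) ∂(μHE[n] : Measure M) ≤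
        (1 + δ : NNReal) * ∫⁻ x, ‖f j x - c‖ₑ ^ 2 * ENNReal.ofReal (ρ x) ∂(μHE[n] : Measure M) +
          (γ * Cρ : NNReal) * ∫⁻ x, ‖f j x - u x‖ₑ ^ 2 ∂(μHE[n] : Measure M) := by
      refine lintegral_mul_le_add (by fun_prop) hρ.measurable.ennreal_ofReal hCρ' fun x ↦ ?_
      have := enorm_add_sq_le (f j x - c) (-(f j x - u x)) hδ
      rw [enorm_neg] at this
      convert this using 3
      ring
    have a3 : ∫⁻ x, ‖riemannianGradient I (f j) x‖ₑ ^ 2 * ENNReal.ofReal (σ x)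
        ∂(μHE[n] : Measure M) ≤
        (1 + δ : NNReal) * W +
          (γ * Cσ : NNReal) *
          ∫⁻ x, ‖riemannianGradient I (f j) x - V x‖ₑ ^ 2 ∂(μHE[n] : Measure M) := by
      refine lintegral_mul_le_add (hVm'.pow_const 2) hσ.measurable.ennreal_ofReal hCσ' fun x ↦ ?_
      have := enorm_add_sq_le (V x) (riemannianGradient I (f j) x - V x) hδ
      rwa [add_sub_cancel] at this
    have a4 : (k : ℝ≥0∞) * ∫⁻ x, ‖f j x - c‖ₑ ^ 2 * ENNReal.ofReal (ρ x) ∂(μHE[n] : Measure M) ≤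
        ∫⁻ x, ‖riemannianGradient I (f j) x‖ₑ ^ 2 * ENNReal.ofReal (σ x) ∂(μHE[n] : Measure M) := by
      refine le_trans (mul_le_mul' hk (le_of_eq ?_)) hc
      exact lintegral_congr fun x ↦ mul_comm _ _
    set Y := ∫⁻ x, ‖f j x - c‖ₑ ^ 2 * ENNReal.ofReal (ρ x) ∂(μHE[n] : Measure M)
    set Z := ∫⁻ x, ‖riemannianGradient I (f j) x‖ₑ ^ 2 * ENNReal.ofReal (σ x) ∂(μHE[n] : Measure M)
    set e1 := ∫⁻ x, ‖riemannianGradient I (f j) x - V x‖ₑ ^ 2 ∂(μHE[n] : Measure M)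
    set e2 := ∫⁻ x, ‖f j x - u x‖ₑ ^ 2 ∂(μHE[n] : Measure M)
    calc (k : ℝ≥0∞) * U ≤ k * ((1 + δ : NNReal) * Y + (γ * Cρ : NNReal) * e2) :=
          mul_le_mul' le_rfl (a1.trans a2)
      _ = (1 + δ : NNReal) * (k * Y) + (k * (γ * Cρ) : NNReal) * e2 := by
          rw [ENNReal.coe_mul k]; ring
      _ ≤ (1 + δ : NNReal) * ((1 + δ : NNReal) * W + (γ * Cσ : NNReal) * e1) +
          (k * (γ * Cρ) : NNReal) * e2 := by
          gcongr
          exact a4.trans a3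
      _ = _ := by
          rw [ENNReal.coe_mul (1 + δ), ENNReal.coe_mul (1 + δ)]; ring
  have hlim : Tendsto (fun j ↦ ((1 + δ) * (1 + δ) : NNReal) * W +
      (((1 + δ) * (γ * Cσ) : NNReal) *
          ∫⁻ x, ‖riemannianGradient I (f j) x - V x‖ₑ ^ 2 ∂(μHE[n] : Measure M) +
        (k * (γ * Cρ) : NNReal) * ∫⁻ x, ‖f j x - u x‖ₑ ^ 2 ∂(μHE[n] : Measure M))) atTop
      (𝓝 (((1 + δ) * (1 + δ) : NNReal) * W + (((1 + δ) * (γ * Cσ) : NNReal) * 0 +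
        (k * (γ * Cρ) : NNReal) * 0))) :=
    tendsto_const_nhds.add ((ENNReal.Tendsto.const_mul hfV (Or.inr ENNReal.coe_ne_top)).add
      (ENNReal.Tendsto.const_mul hfu (Or.inr ENNReal.coe_ne_top)))
  have := ge_of_tendsto' hlim hj
  simpa using this

end Sobolev

end WeightedNeumann

end

/-- The model with corners `I` may be `𝓡 n` (closed manifolds) or `𝓡∂ n` (manifolds with
boundary). All quantities live in `[0, ∞]`. -/
theorem theorem3p2 {n : ℕ} (hn : 2 ≤ n) {H : Type*} [TopologicalSpace H]
    (I : ModelWithCorners ℝ (EuclideanSpace ℝ (Fin n)) H)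
    {M : Type*} [EMetricSpace M] [CompactSpace M] [Nonempty M]
    [MeasurableSpace M] [BorelSpace M]
    [ChartedSpace H M] [IsManifold I ∞ M]
    [RiemannianBundle (fun x : M ↦ TangentSpace I x)]
    [IsContMDiffRiemannianBundle I ∞ (EuclideanSpace ℝ (Fin n)) (fun x : M ↦ TangentSpace I x)]
    [IsRiemannianManifold I M]
    (ρ σ : M → ℝ) (hρ : Continuous ρ) (hσ : Continuous σ)
    (hρ_pos : ∀ x, 0 < ρ x) (hσ_pos : ∀ x, 0 < σ x) :
    (1 / 4 : ℝ≥0∞) * WeightedNeumann.cheegerConstant I σ σ *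
        WeightedNeumann.cheegerConstant I ρ σ ≤
      WeightedNeumann.eigenvalue (M := M) I ρ σ 1 := by
  have : IsContinuousRiemannianBundle (EuclideanSpace ℝ (Fin n))
      (fun x : M ↦ TangentSpace I x) := by
    obtain ⟨g, hg, hg'⟩ := IsContMDiffRiemannianBundle.exists_contMDiff (IB := I) (n := ∞)
      (F := EuclideanSpace ℝ (Fin n)) (E := fun x : M ↦ TangentSpace I x)
    exact ⟨g, hg.continuous, hg'⟩
  have hfin : IsFiniteMeasure (μHE[n] : Measure M) :=
    WeightedNeumann.isFiniteMeasure_riemannianVolume I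
  obtain ⟨C, hC⟩ := (isCompact_univ (X := M)).bddAbove_image hρ.continuousOn
  have hC' : ∀ x, ρ x ≤ C := fun x ↦ hC (mem_image_of_mem _ (mem_univ x))
  refine le_iInf fun E ↦ le_iInf fun hE ↦ le_iInf fun hH1 ↦ ?_
  obtain ⟨u, huE, hu0, hmean⟩ := WeightedNeumann.exists_mem_ne_zero_integral_eq_zero
    (ρ := ρ) hρ.aestronglyMeasurable
    (fun x ↦ by rw [Real.norm_of_nonneg (hρ_pos x).le]; exact hC' x) E hE
  refine le_iSup_of_le u (le_iSup_of_le huE (le_iSup_of_le hu0 ?_))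
  have hgrad : WeightedNeumann.IsSobolevGradient I u (WeightedNeumann.sobolevGradient I u) := by
    have h := hH1 u huE
    rw [WeightedNeumann.sobolevGradient, dif_pos h]
    exact h.choose_spec
  have key := WeightedNeumann.cheegerConstant_mul_lintegral_le_of_isSobolevGradient I
    (m := n - 1) (by lia) hρ hσ hρ_pos hσ_pos hgrad hmean
  have hum : Measurable fun x ↦ ‖u x‖ₑ ^ 2 * ENNReal.ofReal (ρ x) :=
    ((Lp.stronglyMeasurable u).measurable.enorm.pow_const 2).mul hρ.measurable.ennreal_ofReal
  rw [WeightedNeumann.rayleighQuotient, ENNReal.le_div_iff_mul_le]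
  · exact key
  · left
    intro hzero
    rw [lintegral_eq_zero_iff hum] at hzero
    refine hu0 ((Lp.eq_zero_iff_ae_eq_zero).2 ?_)
    filter_upwards [hzero] with x hx
    have hx' : u x = 0 ∨ ρ x ≤ 0 := by simpa using hx
    exact hx'.resolve_right (hρ_pos x).not_ge
  · left
    have hsq : ∫⁻ x, ‖u x‖ₑ ^ 2 ∂(μHE[n] : Measure M) < ⊤ := by
      have := lintegral_rpow_enorm_lt_top_of_eLpNorm_lt_top (p := 2) two_ne_zero
        ENNReal.ofNat_ne_top (Lp.memLp u).eLpNorm_lt_top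
      simpa using this
    refine ne_top_of_le_ne_top (ENNReal.mul_ne_top (ENNReal.ofReal_ne_top (r := C)) hsq.ne) ?_
    rw [← lintegral_const_mul' _ _ ENNReal.ofReal_ne_top]
    refine lintegral_mono fun x ↦ ?_
    rw [mul_comm]
    gcongr
    exact hC' x
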